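/- Let $f:\mathbb R\to\mathbb R$ be piecewise smooth: $\mathbb R$ is a disjoint union of finitely many intervals, on each of which $f$ is continuously differentiable and either strictly monotonic or constant; and $H(\lfloor f(Z)\rfloor)<\infty$ for $Z\sim\mathcal N(0,1)$, where $H$ is Shannon entropy. Assume that the information dimension $d(f(Z))=\lim_{M\to\infty}H(\lfloor Mf(Z)\rfloor/M)/\log M$ exists and $d(f(Z))\neq0$. Let $\delta>1$, and let $P_\lambda$ denote a probability law with support in a compact interval $[a,b]$, $a>0$, and $\mathbb E[\lambda]=\delta$. *Noiseless threshold.* For $v\in(0,1]$ let $\mathsf{mmse}_z(v)=\mathbb E\big[(Z-\mathbb E[Z\mid \sqrt{v^{-1}-1}\,Z+N,\,f(Z)])^2\big]$ with $Z,N$ independent standard Gaussians, $\phi(v)=\big(\tfrac1{\mathsf{mmse}_z(v)}-\tfrac1v\big)^{-1}\in[0,\infty]$, $\phi(0)=\lim_{v\to0+}\phi(v)$, and $\mathsf{MSE}_\lambda(V)=\mathbb E\big[\tfrac{V}{V+\lambda}\big]$ (with $\mathsf{MSE}_\lambda(\infty)=1$). For $\delta'>1$ put $P_{\delta'}(v)=\mathsf{MSE}_\lambda(\phi(v))-\big[1-\delta'\big(1-\tfrac{\mathsf{mmse}_z(v)}{v}\big)\big]$,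 let $V_r^\star$ be the infimum of the $v\in(0,1]$ such that $P_{\delta'}(u)>0$ for all $u\in[v,1]$ ($V_r^\star=1$ if there is none), and let $\mathsf{MSE}^\star_{\lambda}=\mathsf{MSE}_\lambda(\phi(V_r^\star))$. Define $\delta^{\mathsf p}_\lambda=\inf\{\delta'>1:\mathsf{MSE}^\star_\lambda=0\}$ (with $P_\lambda$ fixed, and $\inf\emptyset=+\infty$). *Noisy state evolution.* For the model $\boldsymbol y=f(\boldsymbol{Ax}+\boldsymbol w)$ with noise variance $\sigma_w^2>0$, let $\mathsf{mmse}_z(v,\sigma_w^2)=\mathbb E\big[(Z-\mathbb E[Z\mid f(Z+\sigma_wW),\,(1-v)Z+\sqrt{v(1-v)}N])^2\big]$ with $Z,W,N$ independent standard Gaussians, $\phi(v,\sigma_w^2)=\big(\tfrac1{\mathsf{mmse}_z(v,\sigma_w^2)}-\tfrac1v\big)^{-1}\in[0,\infty]$, $\Phi(V)=\Big(\big(\tfrac1\delta\mathbb E\big[\tfrac{V\lambda}{V+\lambda}\big]\big)^{-1}-\tfrac1V\Big)^{-1}$, and define $V_r^{-1}=1$ (the superscript being an index), $V_l^t=\phi(V_r^{t-1},\sigma_w^2)$,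 $V_r^t=\Phi(V_l^t)$ for $t\ge0$. *Claim.* There is a constant $0<C(\delta,f)<\infty$ depending only on $\delta$ and $f$ such that, for every such $P_\lambda$ with $\delta>\delta^{\mathsf p}_\lambda$: the limit $\mathsf{MSE}^\star_\lambda(\sigma_w^2)=\lim_{t\to\infty}\mathsf{MSE}_\lambda(V_l^t)$ exists for every $\sigma_w^2>0$, and $$\mathsf{MSE}^\star_\lambda(\sigma_w^2)=C(\delta,f)\,\mathbb E[\lambda^{-1}]\,\sigma_w^2\,(1+o(1))\qquad(\sigma_w^2\to0).$$ Hence recovery is stable: $\sup_{\sigma_w>0}\mathsf{MSE}^\star_\lambda(\sigma_w^2)/\sigma_w^2<\infty$. -/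

import Mathlib

open MeasureTheory ProbabilityTheory Filter Topology Asymptotics
open scoped ENNReal NNReal

namespace GLMEP

noncomputable section

/-! ### Information dimension -/

/-- Shannon entropy (in nats) of a probability measure on the integers, with value in `[0, ∞]`. -/
def entropy (ν : Measure ℤ) : ℝ≥0∞ :=
  ∑' k : ℤ, ENNReal.ofReal (Real.negMulLog (ν.real {k}))

/-- `H(⟨X⟩_M)` for `X ∼ ν`, where `⟨X⟩_M = ⌊M X⌋ / M`. The entropy is computed from the law of the
integer `⌊M X⌋`, which is `⟨X⟩_M` up to the injective relabelling `k ↦ k / M`. -/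
def quantizedEntropy (ν : Measure ℝ) (M : ℕ) : ℝ≥0∞ :=
  entropy (ν.map fun x => ⌊(M : ℝ) * x⌋)

/-- The information dimension of a random variable with law `ν` exists and equals `d`:
`H(⟨X⟩_M) / log M → d` as `M → ∞`. -/
def HasInformationDimension (ν : Measure ℝ) (d : ℝ≥0) : Prop :=
  Tendsto (fun M : ℕ => quantizedEntropy ν M / ENNReal.ofReal (Real.log M)) atTop (𝓝 (d : ℝ≥0∞))

/-- The standard Gaussian law. -/
abbrev stdGaussian : Measure ℝ := gaussianReal 0 1

/-- The law of `f(Z)`, where `Z ∼ N(0,1)`. -/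
def outputLaw (f : ℝ → ℝ) : Measure ℝ := stdGaussian.map f

/-! ### Assumption on the nonlinearity -/

/-- `f` is piecewise smooth: the real line is the disjoint union of finitely many intervals, on each
of which `f` is continuously differentiable and either strictly monotonic or constant; moreover
`H(⌊f(Z)⌋) < ∞` for `Z ∼ N(0,1)`. -/
def PiecewiseSmooth (f : ℝ → ℝ) : Prop :=
  (∃ (K : ℕ) (I : Fin K → Set ℝ),
    (∀ k, (I k).OrdConnected) ∧ Pairwise (fun j k => Disjoint (I j) (I k)) ∧
    (⋃ k, I k) = Set.univ ∧
    ∀ k, ContDiffOn ℝ 1 f (I k) ∧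
      (StrictMonoOn f (I k) ∨ StrictAntiOn f (I k) ∨ ∃ c, ∀ x ∈ I k, f x = c)) ∧
  quantizedEntropy (outputLaw f) 1 ≠ ∞

/-- Assumption on the limiting eigenvalue law `P` of `AᵀA` at sampling ratio `δ`: `P` is a probability
measure supported in a compact interval `[a, b]` with `a > 0`, and `E[λ] = δ > 1`. -/
structure IsSpectralLaw (P : Measure ℝ) (δ : ℝ) : Prop where
  isProb : IsProbabilityMeasure P
  support : ∃ a b : ℝ, 0 < a ∧ ∀ᵐ x ∂P, x ∈ Set.Icc a b
  one_lt : 1 < δ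
  mean : ∫ x, x ∂P = δ

/-! ### Minimum mean square errors -/

/-- `E[(Z - E[Z | T])²]`. -/
def mmseGiven {Ω 𝒯 : Type*} [MeasurableSpace Ω] [MeasurableSpace 𝒯]
    (μ : Measure Ω) (Z : Ω → ℝ) (T : Ω → 𝒯) : ℝ :=
  ∫ ω, (Z ω - (μ[Z | MeasurableSpace.comap T inferInstance]) ω) ^ 2 ∂μ

/-- The noiseless `mmse_z(v) = mmse(Z, v⁻¹ - 1 | f(Z))`, that is
`E[(Z - E[Z | √snr Z + N, f(Z)])²]` with `snr = v⁻¹ - 1`, for independent standard Gaussian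
`Z = ω.1` and `N = ω.2`; here `0 < v ≤ 1`. -/
def mmseZ (f : ℝ → ℝ) (v : ℝ) : ℝ :=
  mmseGiven (stdGaussian.prod stdGaussian) (fun ω : ℝ × ℝ => ω.1)
    (fun ω : ℝ × ℝ => (√(v⁻¹ - 1) * ω.1 + ω.2, f ω.1))

/-- The noisy `mmse_z(v, σ²) = E[(Z - E[Z | Y_σ, Z_r])²]`, where `Y_σ = f(Z + σ W)` and
`Z_r = (1 - v) Z + √(v (1 - v)) N`, for independent standard Gaussian
`Z = ω.1`, `W = ω.2.1`, `N = ω.2.2`. The argument `s` is the noise variance `σ²`. -/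
def mmseZNoisy (f : ℝ → ℝ) (s v : ℝ) : ℝ :=
  mmseGiven (stdGaussian.prod (stdGaussian.prod stdGaussian)) (fun ω : ℝ × ℝ × ℝ => ω.1)
    (fun ω : ℝ × ℝ × ℝ => (f (ω.1 + √s * ω.2.1), (1 - v) * ω.1 + √(v * (1 - v)) * ω.2.2))

/-! ### State evolution

The quantities `V_l` may be infinite, so they take values in `[0, ∞]`. -/

/-- `(1 / m - 1 / v)⁻¹` for `0 ≤ m ≤ v`, `v > 0`; it is `0` for `m = 0` and `∞` for `m = v`. -/
def extrinsic (m v : ℝ) : ℝ≥0∞ := ((ENNReal.ofReal m)⁻¹ - (ENNReal.ofReal v)⁻¹)⁻¹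

/-- The noiseless map `φ(v)`, `0 < v ≤ 1`. -/
def phi (f : ℝ → ℝ) (v : ℝ) : ℝ≥0∞ := extrinsic (mmseZ f v) v

/-- The noisy map `φ(v, σ²)`, `0 < v ≤ 1`, with `s = σ²`. -/
def phiNoisy (f : ℝ → ℝ) (s v : ℝ) : ℝ≥0∞ := extrinsic (mmseZNoisy f s v) v

/-- `Φ(V) = (1 / (δ⁻¹ E[V λ / (V + λ)]) - 1 / V)⁻¹`, where `V λ / (V + λ) = (1 / V + 1 / λ)⁻¹`.
In particular `Φ(0) = 0` and `Φ(∞) = E[λ] / δ`. -/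
def PhiMap (P : Measure ℝ) (δ : ℝ) (V : ℝ≥0∞) : ℝ :=
  (((ENNReal.ofReal δ)⁻¹ * ∫⁻ x, (V⁻¹ + (ENNReal.ofReal x)⁻¹)⁻¹ ∂P)⁻¹ - V⁻¹)⁻¹.toReal

/-- `MSE_λ(V) = E[V / (V + λ)]`, written as `E[(1 + λ / V)⁻¹]` so that the values at `V = 0` and
`V = ∞` are `0` and `1`. -/
def mse (P : Measure ℝ) (V : ℝ≥0∞) : ℝ :=
  ∫ x, ((1 + ENNReal.ofReal x / V)⁻¹).toReal ∂P

/-- `V_r^{t-1}` in the noisy setting: the sequence starts at `1`, and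
`V_r^t = Φ(φ(V_r^{t-1}, σ²))`. -/
def VrNoisy (f : ℝ → ℝ) (P : Measure ℝ) (δ s : ℝ) : ℕ → ℝ
  | 0 => 1
  | t + 1 => PhiMap P δ (phiNoisy f s (VrNoisy f P δ s t))

/-- `V_l^t = φ(V_r^{t-1}, σ²)`. -/
def VlNoisy (f : ℝ → ℝ) (P : Measure ℝ) (δ s : ℝ) (t : ℕ) : ℝ≥0∞ :=
  phiNoisy f s (VrNoisy f P δ s t)

/-- `MSE*_λ(σ²) = lim_{t → ∞} MSE_λ(V_l^t)`, with `s = σ²`. -/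
def mseStarNoisy (f : ℝ → ℝ) (P : Measure ℝ) (δ s : ℝ) : ℝ :=
  limUnder atTop fun t : ℕ => mse P (VlNoisy f P δ s t)

/-! ### The noiseless fixed point and the perfect recovery threshold -/

/-- `P(v) = E[φ(v) / (φ(v) + λ)] - [1 - δ (1 - mmse_z(v) / v)]`. -/
def Pfun (f : ℝ → ℝ) (P : Measure ℝ) (δ v : ℝ) : ℝ :=
  mse P (phi f v) - (1 - δ * (1 - mmseZ f v / v))

/-- The `v` such that `P > 0` on `[v, 1]`. (Whether `v = 0` is admitted does not change
the infimum.) -/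
def positiveSet (f : ℝ → ℝ) (P : Measure ℝ) (δ : ℝ) : Set ℝ :=
  {v | v ∈ Set.Ioc (0 : ℝ) 1 ∧ ∀ u ∈ Set.Icc v 1, 0 < Pfun f P δ u}

open Classical in
/-- `V_r^* = inf {v ∈ [0, 1] : P(u) > 0 for all u ∈ [v, 1]}`, and `V_r^* = 1` if there is no
such `v`. -/
def VrStar (f : ℝ → ℝ) (P : Measure ℝ) (δ : ℝ) : ℝ :=
  if (positiveSet f P δ).Nonempty then sInf (positiveSet f P δ) else 1

open Classical in
/-- `φ` on `[0, 1]`, with `φ(0) = lim_{v → 0+} φ(v)`. -/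
def phiExt (f : ℝ → ℝ) (v : ℝ) : ℝ≥0∞ :=
  if v = 0 then limUnder (𝓝[>] (0 : ℝ)) (phi f) else phi f v

/-- The noiseless final error `MSE*_λ = MSE_λ(φ(V_r^*))`. -/
def mseStar (f : ℝ → ℝ) (P : Measure ℝ) (δ : ℝ) : ℝ :=
  mse P (phiExt f (VrStar f P δ))

/-- `δ^p_λ = inf {δ > 1 : MSE*_λ = 0}`, which is `+∞` if there is no such `δ`. -/
def perfectThreshold (f : ℝ → ℝ) (P : Measure ℝ) : EReal :=
  sInf ((fun δ : ℝ => (δ : EReal)) '' {δ | 1 < δ ∧ mseStar f P δ = 0})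

end

end GLMEP

/-! The argument works with precisions. For noise variance `s > 0` the precision `w = 1 / V_l`
(`prec`) is a finite real, and one round of state evolution sends `v` to `w = prec f s v` and then
`w` to `1 / specPsi P δ w`. Gaussian side information raises precision (`mmseZNoisy_mul_le`) and
`specPsi` is increasing by Jensen (`specF_mul_le`). Started at `1`, the recursion is therefore
monotone and converges, with limits `W` for the precisions and `V = 1 / specPsi P δ W`
(`exists_limit`). Along it, the MMSE divided by `v` tends to `1 / (1 + V W) = (δ - 1 + specMu P W) /
δ` (`ratio_limit_eq`).

Let `p` be the Gaussian mass of the pieces on which `f` is injective. Near `(v, s) = (0, 0)` the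
side information almost surely singles out the piece. An injective piece reveals `Z + √s W`, a
constant piece reveals nothing more, and so the MMSE over `v` is `1 - p v / (v + s) + o(1)`
(`Pieces.tendsto_ratio`). Nonzero information dimension gives `p > 0` (`Pieces.p_pos`).

If `δ` exceeds the threshold, some `δ' < δ` has `Pfun > 0` on all of `(0, 1]`. Letting `v → 0` gives
`δ' p ≥ 1`, hence `p δ > 1` (`one_le_mul_p`). Positivity, compactness of `[ε, 1]` and upper
semicontinuity of the MMSE give `V → 0` as `s → 0` (`eventually_fixedPoint_lt`). The two expressions
for the ratio then yield `1 - p V / (V + s) → (δ - 1) / δ`, so `s / V → p δ - 1`. Since also `V W →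
1 / (δ - 1)` and `W * specMu P W → E[1/λ]`, the error is asymptotic to `C E[1/λ] s` with `C = (δ -
1) / (p δ - 1)`. -/

namespace GLMEP

/-! ### Variational bounds for the conditional mean square error. -/

section MMSE

variable {Ω Ω' 𝒯 : Type*} [MeasurableSpace Ω] [MeasurableSpace Ω'] [MeasurableSpace 𝒯]
  {μ : Measure Ω} {ν : Measure Ω'} {Z : Ω → ℝ} {T : Ω → 𝒯}

/-- The mean square error of any square integrable estimator bounds `mmseGiven` from above. -/
lemma mmseGiven_le [IsProbabilityMeasure μ] (hT : Measurable T) (hZ : MemLp Z 2 μ)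
    {g : 𝒯 → ℝ} (hg : Measurable g) (hgT : MemLp (fun ω => g (T ω)) 2 μ) :
    mmseGiven μ Z T ≤ ∫ ω, (Z ω - g (T ω)) ^ 2 ∂μ := by
  have hm := hT.comap_le
  unfold mmseGiven
  set m := MeasurableSpace.comap T inferInstance with hmdef
  set E := μ[Z | m] with hE
  have hE2 : MemLp E 2 μ := MemLp.condExp one_le_two hZ
  have hk : StronglyMeasurable[m] (fun ω => E ω - g (T ω)) := by
    refine stronglyMeasurable_condExp.sub ?_
    exact (hg.comp (comap_measurable T)).stronglyMeasurable
  have hk2 : MemLp (fun ω => E ω - g (T ω)) 2 μ := hE2.sub hgT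
  have hZE : MemLp (fun ω => Z ω - E ω) 2 μ := hZ.sub hE2
  have hcross : ∫ ω, (Z ω - E ω) * (E ω - g (T ω)) ∂μ = 0 := by
    have h1 : Integrable ((fun ω => Z ω - E ω) * (fun ω => E ω - g (T ω))) μ :=
      hZE.integrable_mul hk2
    have h2 := condExp_mul_of_stronglyMeasurable_right hk h1 (hZE.integrable one_le_two)
    have h3 : μ[(fun ω => Z ω - E ω) | m] =ᵐ[μ] 0 := by
      have h4 := condExp_sub (hZ.integrable one_le_two) (hE2.integrable one_le_two) m
      have h5 : μ[E | m] = E :=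
        condExp_of_stronglyMeasurable hm stronglyMeasurable_condExp (hE2.integrable one_le_two)
      filter_upwards [h4] with ω h4
      change (μ[Z - E | m]) ω = 0
      rw [h4, h5, Pi.sub_apply, hE, sub_self]
    have h6 := integral_condExp hm (f := (fun ω => Z ω - E ω) * (fun ω => E ω - g (T ω))) (μ := μ)
    change ∫ ω, ((fun ω => Z ω - E ω) * (fun ω => E ω - g (T ω))) ω ∂μ = 0
    have h7 : μ[(fun ω => Z ω - E ω) * (fun ω => E ω - g (T ω)) | m] =ᵐ[μ] fun _ => (0 : ℝ) := by
      filter_upwards [h2, h3] with ω h2 h3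
      rw [h2, Pi.mul_apply, h3, Pi.zero_apply, zero_mul]
    rw [← h6, integral_congr_ae h7, integral_zero]
  have hexp : ∫ ω, (Z ω - g (T ω)) ^ 2 ∂μ
      = ∫ ω, (Z ω - E ω) ^ 2 ∂μ + (2 * ∫ ω, (Z ω - E ω) * (E ω - g (T ω)) ∂μ
        + ∫ ω, (E ω - g (T ω)) ^ 2 ∂μ) := by
    have i1 := hZE.integrable_sq
    have i2 := (hZE.integrable_mul hk2).const_mul 2
    have i3 := hk2.integrable_sq
    rw [← integral_const_mul, ← integral_add (by simpa using! i2) i3,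
      ← integral_add i1 (by simpa using! i2.add i3)]
    congr 1 with ω
    ring
  rw [hexp, hcross]
  have : 0 ≤ ∫ ω, (E ω - g (T ω)) ^ 2 ∂μ := integral_nonneg fun ω => sq_nonneg _
  linarith

/-- `mmseGiven` is attained by a measurable estimator. -/
lemma exists_estimator [IsProbabilityMeasure μ] (hZ : MemLp Z 2 μ) (T : Ω → 𝒯) :
    ∃ g : 𝒯 → ℝ, Measurable g ∧ MemLp (fun ω => g (T ω)) 2 μ ∧
      mmseGiven μ Z T = ∫ ω, (Z ω - g (T ω)) ^ 2 ∂μ := by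
  obtain ⟨g, hg, hgT⟩ := (stronglyMeasurable_condExp (μ := μ) (f := Z)
    (m := MeasurableSpace.comap T inferInstance)).exists_eq_measurable_comp
  refine ⟨g, hg.measurable, ?_, ?_⟩
  · change MemLp (g ∘ T) 2 μ
    rw [← hgT]
    exact MemLp.condExp one_le_two hZ
  · unfold mmseGiven
    rw [hgT]
    rfl

lemma mmseGiven_nonneg : 0 ≤ mmseGiven μ Z T := integral_nonneg fun _ => sq_nonneg _

/-- A test function orthogonal to all estimators bounds `mmseGiven` from below. -/
lemma le_mmseGiven [IsProbabilityMeasure μ] (hZ : MemLp Z 2 μ) {h : Ω → ℝ} (hh : MemLp h 2 μ)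
    (horth : ∀ g : 𝒯 → ℝ, Measurable g → MemLp (fun ω => g (T ω)) 2 μ →
      ∫ ω, h ω * g (T ω) ∂μ = 0) :
    2 * (∫ ω, Z ω * h ω ∂μ) - ∫ ω, h ω ^ 2 ∂μ ≤ mmseGiven μ Z T := by
  obtain ⟨g, hg, hgT, hm⟩ := exists_estimator hZ T
  rw [hm]
  have i1 : Integrable (fun ω => Z ω * h ω) μ := hZ.integrable_mul hh
  have i2 : Integrable (fun ω => h ω * g (T ω)) μ := hh.integrable_mul hgT
  have i3 := hh.integrable_sq
  have i4 : Integrable (fun ω => 2 * (Z ω * h ω) - 2 * (h ω * g (T ω)) - h ω ^ 2) μ :=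
    ((i1.const_mul 2).sub (i2.const_mul 2)).sub i3
  have key : ∫ ω, (2 * (Z ω * h ω) - 2 * (h ω * g (T ω)) - h ω ^ 2) ∂μ
      = 2 * (∫ ω, Z ω * h ω ∂μ) - ∫ ω, h ω ^ 2 ∂μ := by
    have i5 : Integrable (fun ω => 2 * (Z ω * h ω) - 2 * (h ω * g (T ω))) μ :=
      (i1.const_mul 2).sub (i2.const_mul 2)
    rw [integral_sub i5 i3, integral_sub (i1.const_mul 2) (i2.const_mul 2), integral_const_mul, integral_const_mul,
      horth g hg hgT]
    ring
  rw [← key]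
  refine integral_mono i4 (hZ.sub hgT).integrable_sq fun ω => ?_
  nlinarith [sq_nonneg (Z ω - g (T ω) - h ω)]

/-- `mmseGiven` only depends on the joint law. -/
lemma mmseGiven_comp [IsProbabilityMeasure μ] [IsProbabilityMeasure ν] {Θ : Ω' → Ω}
    (hΘ : MeasurePreserving Θ ν μ) (hT : Measurable T) (hZ : MemLp Z 2 μ) :
    mmseGiven ν (fun ω => Z (Θ ω)) (fun ω => T (Θ ω)) = mmseGiven μ Z T := by
  have hint : ∀ g : 𝒯 → ℝ, Measurable g → MemLp (fun ω => g (T ω)) 2 μ →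
      ∫ ω, (Z (Θ ω) - g (T (Θ ω))) ^ 2 ∂ν = ∫ ω, (Z ω - g (T ω)) ^ 2 ∂μ := by
    intro g hg hgT
    have := integral_map (μ := ν) hΘ.measurable.aemeasurable
      (f := fun ω => (Z ω - g (T ω)) ^ 2) (by
        rw [hΘ.map_eq]; exact (hZ.sub hgT).integrable_sq.aestronglyMeasurable)
    rw [hΘ.map_eq] at this
    exact this.symm
  have hZ' : MemLp (fun ω => Z (Θ ω)) 2 ν := hZ.comp_measurePreserving hΘ
  apply le_antisymm
  · obtain ⟨g, hg, hgT, hm⟩ := exists_estimator hZ T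
    rw [hm, ← hint g hg hgT]
    exact mmseGiven_le (hT.comp hΘ.measurable) hZ' hg (hgT.comp_measurePreserving hΘ)
  · obtain ⟨g, hg, hgT, hm⟩ := exists_estimator hZ' (fun ω => T (Θ ω))
    have hgT' : MemLp (fun ω => g (T ω)) 2 μ := by
      rw [← hΘ.map_eq]
      refine (memLp_map_measure_iff ?_ hΘ.measurable.aemeasurable).2 hgT
      exact (hg.comp hT).aestronglyMeasurable
    rw [hm, hint g hg hgT']
    exact mmseGiven_le hT hZ hg hgT'

/-- Independent randomization of the estimator does not help. -/
lemma mmseGiven_le_randomized [IsProbabilityMeasure μ] [IsProbabilityMeasure ν]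
    (hT : Measurable T) (hZ : MemLp Z 2 μ) {g : 𝒯 × Ω' → ℝ} (hg : Measurable g)
    (hgT : MemLp (fun ω : Ω × Ω' => g (T ω.1, ω.2)) 2 (μ.prod ν)) :
    mmseGiven μ Z T ≤ ∫ ω, (Z ω.1 - g (T ω.1, ω.2)) ^ 2 ∂(μ.prod ν) := by
  have hZ' : MemLp (fun ω : Ω × Ω' => Z ω.1) 2 (μ.prod ν) :=
    hZ.comp_measurePreserving measurePreserving_fst
  have hint : Integrable (fun ω : Ω × Ω' => (Z ω.1 - g (T ω.1, ω.2)) ^ 2) (μ.prod ν) :=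
    (hZ'.sub hgT).integrable_sq
  rw [integral_prod_symm _ hint]
  have hslice : ∀ᵐ y ∂ν, mmseGiven μ Z T ≤ ∫ x, (Z x - g (T x, y)) ^ 2 ∂μ := by
    filter_upwards [hgT.integrable_sq.prod_left_ae] with y hy
    refine mmseGiven_le hT hZ (g := fun t => g (t, y)) (hg.comp (by fun_prop)) ?_
    refine (memLp_two_iff_integrable_sq ?_).2 hy
    exact (hg.comp (hT.prodMk measurable_const)).aestronglyMeasurable
  calc mmseGiven μ Z T = ∫ _, mmseGiven μ Z T ∂ν := by simp
    _ ≤ _ := integral_mono_ae (integrable_const _) hint.integral_prod_right hslice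

end MMSE

/-! ### Gaussian changes of variables and comparison of side information. -/

section Gaussian

/-- The law of three independent standard Gaussians. -/
noncomputable abbrev gauss3 : Measure (ℝ × ℝ × ℝ) := stdGaussian.prod (stdGaussian.prod stdGaussian)

/-- A rotation followed by a sign flip. The reflection form is convenient because the matrix is its
own inverse, so the same map serves in both directions of a change of variables. -/
lemma measurePreserving_reflection {a b : ℝ} (hab : a ^ 2 + b ^ 2 = 1) :
    MeasurePreserving (fun x : ℝ × ℝ => (a * x.1 + b * x.2, b * x.1 - a * x.2))
      (stdGaussian.prod stdGaussian) (stdGaussian.prod stdGaussian) := by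
  have hz : ‖(⟨a, b⟩ : ℂ)‖ = 1 := by
    rw [← sq_eq_sq₀ (norm_nonneg _) zero_le_one, Complex.sq_norm, Complex.normSq_mk]
    linarith [hab]
  have hc : Real.cos (Complex.arg ⟨a, b⟩) = a := by
    have := Complex.norm_mul_cos_arg ⟨a, b⟩
    rwa [hz, one_mul] at this
  have hs : Real.sin (Complex.arg ⟨a, b⟩) = b := by
    have := Complex.norm_mul_sin_arg ⟨a, b⟩
    rwa [hz, one_mul] at this
  have hmean : ∀ L : StrongDual ℝ ℝ, stdGaussian[L] = 0 := by
    intro L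
    have : (fun x => L x) = fun x => x * L 1 := by
      ext x
      rw [← smul_eq_mul, ← L.map_smul, smul_eq_mul, mul_one]
    rw [this, integral_mul_const, integral_id_gaussianReal, zero_mul]
  have hrot : MeasurePreserving (fun x : ℝ × ℝ => (a * x.1 + b * x.2, -b * x.1 + a * x.2))
      (stdGaussian.prod stdGaussian) (stdGaussian.prod stdGaussian) := by
    refine ⟨by fun_prop, ?_⟩
    have := IsGaussian.map_rotation_eq_self_of_forall_strongDual_eq_zero
      hmean (Complex.arg ⟨a, b⟩)
    convert! this using 2
    ext x <;> simp [ContinuousLinearMap.rotation_apply, hc, hs]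
  have hneg : MeasurePreserving (fun x : ℝ => -x) stdGaussian stdGaussian :=
    ⟨by fun_prop, by rw [gaussianReal_map_neg, neg_zero]⟩
  have := ((MeasurePreserving.id stdGaussian).prod hneg).comp hrot
  convert! this using 1
  ext x <;> simp
  ring

lemma memLp_id_std : MemLp (fun x : ℝ => x) 2 stdGaussian := memLp_id_gaussianReal 2

lemma memLp_fst3 : MemLp (fun ω : ℝ × ℝ × ℝ => ω.1) 2 gauss3 :=
  memLp_id_std.comp_measurePreserving measurePreserving_fst

lemma memLp_snd3 : MemLp (fun ω : ℝ × ℝ × ℝ => ω.2.1) 2 gauss3 :=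
  memLp_id_std.comp_measurePreserving (measurePreserving_fst.comp measurePreserving_snd)

lemma memLp_thd3 : MemLp (fun ω : ℝ × ℝ × ℝ => ω.2.2) 2 gauss3 :=
  memLp_id_std.comp_measurePreserving (measurePreserving_snd.comp measurePreserving_snd)

lemma integral_sq_std : ∫ x, x ^ 2 ∂stdGaussian = 1 := by
  have h := variance_fun_id_gaussianReal (μ := 0) (v := 1)
  rw [variance_eq_integral (by fun_prop)] at h
  simpa using h

lemma integral_id_std : ∫ x, x ∂stdGaussian = 0 := integral_id_gaussianReal

lemma sqrt_mul_one_sub {v : ℝ} (hv : 0 < v) : √(v * (1 - v)) = v * √(v⁻¹ - 1) := by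
  have : v * (1 - v) = v ^ 2 * (v⁻¹ - 1) := by field_simp
  rw [this, Real.sqrt_mul (sq_nonneg v), Real.sqrt_sq hv.le]

lemma inv_sub_one_nonneg {v : ℝ} (hv : 0 < v) (hv1 : v ≤ 1) : 0 ≤ v⁻¹ - 1 :=
  sub_nonneg.2 (one_le_inv_iff₀.2 ⟨hv, hv1⟩)

/-- The signal in the coordinates `(A, U, Q)`. -/
noncomputable def sigC (s v : ℝ) (ω : ℝ × ℝ × ℝ) : ℝ :=
  √(1 - v) * ω.1 + √v * (√(v / (v + s)) * ω.2.1 + √(s / (v + s)) * ω.2.2)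

/-- The observations in the coordinates `(A, U, Q)`. -/
noncomputable def obsC (f : ℝ → ℝ) (s v : ℝ) (ω : ℝ × ℝ × ℝ) : ℝ × ℝ :=
  (f (√(1 - v) * ω.1 + √(v + s) * ω.2.1), √(1 - v) * ω.1)

lemma measurable_obsC {f : ℝ → ℝ} (hf : Measurable f) (s v : ℝ) : Measurable (obsC f s v) := by
  unfold obsC; fun_prop

lemma memLp_sigC (s v : ℝ) : MemLp (sigC s v) 2 gauss3 :=
  (memLp_fst3.const_mul _).add
    (((memLp_snd3.const_mul _).add (memLp_thd3.const_mul _)).const_mul _)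

/-- Orthogonal coordinates: `√(1 - v) A` is the side information `Z_r`, the residual of `Z` and the
channel noise combine into `√(v + s) U` inside `f`, and `Q` is the orthogonal combination, which no
observation sees. -/
lemma mmseZNoisy_eq_coords {f : ℝ → ℝ} (hf : Measurable f) {s v : ℝ} (hs : 0 ≤ s) (hv : 0 < v)
    (hv1 : v ≤ 1) : mmseZNoisy f s v = mmseGiven gauss3 (sigC s v) (obsC f s v) := by
  have hvs : 0 < v + s := by linarith
  have e1 : (√(1 - v)) ^ 2 = 1 - v := Real.sq_sqrt (by linarith)
  have e2 : (√v) ^ 2 = v := Real.sq_sqrt hv.le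
  have e3 : (√(v / (v + s))) ^ 2 = v / (v + s) := Real.sq_sqrt (by positivity)
  have e4 : (√(s / (v + s))) ^ 2 = s / (v + s) := Real.sq_sqrt (by positivity)
  have r1 := measurePreserving_reflection (a := √(1 - v)) (b := √v) (by rw [e1, e2]; ring)
  have r2 := measurePreserving_reflection (a := √(v / (v + s))) (b := √(s / (v + s)))
    (by rw [e3, e4]; field_simp)
  have hid := MeasurePreserving.id stdGaussian
  have p1 := hid.prod r2
  have p2 : MeasurePreserving (fun x : ℝ × ℝ × ℝ => ((x.1, x.2.1), x.2.2)) gauss3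
      ((stdGaussian.prod stdGaussian).prod stdGaussian) :=
    (measurePreserving_prodAssoc stdGaussian stdGaussian stdGaussian).symm
  have p3 := r1.prod hid
  have p4 : MeasurePreserving (fun x : (ℝ × ℝ) × ℝ => (x.1.1, x.1.2, x.2))
      ((stdGaussian.prod stdGaussian).prod stdGaussian) gauss3 :=
    measurePreserving_prodAssoc stdGaussian stdGaussian stdGaussian
  have p5 : MeasurePreserving (fun x : ℝ × ℝ × ℝ => (x.1, x.2.2, x.2.1)) gauss3 gauss3 :=
    hid.prod Measure.measurePreserving_swap
  have p := p5.comp (p4.comp (p3.comp (p2.comp p1)))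
  unfold mmseZNoisy
  rw [← mmseGiven_comp p (by fun_prop) memLp_fst3]
  have s1 : √v * √(v / (v + s)) + √s * √(s / (v + s)) = √(v + s) := by
    rw [Real.sqrt_div hv.le, Real.sqrt_div hs, ← mul_div_assoc, ← mul_div_assoc,
      Real.mul_self_sqrt hv.le, Real.mul_self_sqrt hs, ← add_div]
    exact Real.div_sqrt
  have s2 : √v * √(s / (v + s)) = √s * √(v / (v + s)) := by
    rw [← Real.sqrt_mul hv.le, ← Real.sqrt_mul hs]
    congr 1
    ring
  have s3 : √(v * (1 - v)) = √v * √(1 - v) := Real.sqrt_mul hv.le _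
  congr 1
  funext ω
  obtain ⟨A, U, Q⟩ := ω
  simp only [obsC, Function.comp_apply, Prod.map_apply, id_eq, Prod.mk.injEq]
  refine ⟨congrArg f ?_, ?_⟩
  · linear_combination U * s1 + Q * s2
  · rw [s3]
    linear_combination (-√(1 - v) * A - √v * (√(v / (v + s)) * U + √(s / (v + s)) * Q)) * e1
     + (√(1 - v) * A) * e2 + (√(1 - v) * A) * e1

/-- Upper bound of the noisy MMSE by estimators based on the noiseless side information. -/
lemma mmseZNoisy_le {f : ℝ → ℝ} (hf : Measurable f) {s v : ℝ} (hv : 0 < v)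
    (hv1 : v ≤ 1) {g : ℝ × ℝ → ℝ} (hg : Measurable g)
    (hgT : MemLp (fun ω : ℝ × ℝ × ℝ =>
      g (√(v⁻¹ - 1) * ω.1 + ω.2.2, f (ω.1 + √s * ω.2.1))) 2 gauss3) :
    mmseZNoisy f s v ≤
      ∫ ω, (ω.1 - g (√(v⁻¹ - 1) * ω.1 + ω.2.2, f (ω.1 + √s * ω.2.1))) ^ 2 ∂gauss3 := by
  have hT : Measurable (fun ω : ℝ × ℝ × ℝ =>
      (f (ω.1 + √s * ω.2.1), (1 - v) * ω.1 + √(v * (1 - v)) * ω.2.2)) := by fun_prop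
  rcases hv1.lt_or_eq with hlt | rfl
  · have hk : 0 < √(v⁻¹ - 1) := Real.sqrt_pos.2 (sub_pos.2 ((one_lt_inv₀ hv).2 hlt))
    have e : ∀ ω : ℝ × ℝ × ℝ, √(v⁻¹ - 1) * ω.1 + ω.2.2
        = ((1 - v) * ω.1 + √(v * (1 - v)) * ω.2.2) / (v * √(v⁻¹ - 1)) := by
      intro ω
      have e1 : (1 - v) = v * (√(v⁻¹ - 1) * √(v⁻¹ - 1)) := by
        rw [Real.mul_self_sqrt (inv_sub_one_nonneg hv hv1)]
        field_simp
      rw [sqrt_mul_one_sub hv]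
      rw [e1]
      field_simp
    simp_rw [e] at hgT ⊢
    exact mmseGiven_le hT memLp_fst3 (g := fun t => g (t.2 / (v * √(v⁻¹ - 1)), t.1))
      (hg.comp (by fun_prop)) hgT
  -- At `v = 1` the side information is identically zero, so the noise fed to `g` cannot be
  -- recovered by rescaling. It is an independent randomization instead.
  · have hid := MeasurePreserving.id stdGaussian
    have p1 := ((hid.prod (measurePreserving_fst (μ := stdGaussian) (ν := stdGaussian)))).prod hid
    have p2 : MeasurePreserving (fun x : (ℝ × ℝ) × ℝ => (x.1.1, x.1.2, x.2))
        ((stdGaussian.prod stdGaussian).prod stdGaussian) gauss3 :=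
      measurePreserving_prodAssoc stdGaussian stdGaussian stdGaussian
    have p := p2.comp p1
    have h0 : √((1 : ℝ)⁻¹ - 1) = 0 := by simp
    rw [h0] at hgT ⊢
    simp only [zero_mul, zero_add] at hgT ⊢
    have h1 := hgT.comp_measurePreserving p
    have h2 := mmseGiven_le_randomized (ν := stdGaussian) hT memLp_fst3
      (g := fun t => g (t.2, t.1.1)) (hg.comp (by fun_prop)) h1
    refine h2.trans_eq ?_
    have h3 := integral_map (μ := gauss3.prod stdGaussian) p.measurable.aemeasurable
      (f := fun ω : ℝ × ℝ × ℝ => (ω.1 - g (ω.2.2, f (ω.1 + √s * ω.2.1))) ^ 2)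
      (by rw [p.map_eq]; exact (memLp_fst3.sub hgT).integrable_sq.aestronglyMeasurable)
    rw [p.map_eq] at h3
    exact h3.symm

lemma measurePreserving_drop : MeasurePreserving (fun ω : ℝ × ℝ × ℝ => (ω.1, ω.2.2)) gauss3
    (stdGaussian.prod stdGaussian) :=
  (MeasurePreserving.id stdGaussian).prod measurePreserving_snd

lemma memLp_fst2 : MemLp (fun ω : ℝ × ℝ => ω.1) 2 (stdGaussian.prod stdGaussian) :=
  memLp_id_std.comp_measurePreserving measurePreserving_fst

/-- The noiseless MMSE is the noisy one at noise level zero. -/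
lemma mmseZNoisy_zero {f : ℝ → ℝ} (hf : Measurable f) {v : ℝ} (hv : 0 < v) (hv1 : v ≤ 1) :
    mmseZNoisy f 0 v = mmseZ f v := by
  have hT : Measurable (fun ω : ℝ × ℝ => (√(v⁻¹ - 1) * ω.1 + ω.2, f ω.1)) := by fun_prop
  apply le_antisymm
  · obtain ⟨g, hg, hgT, hm⟩ := exists_estimator memLp_fst2
      (fun ω : ℝ × ℝ => (√(v⁻¹ - 1) * ω.1 + ω.2, f ω.1))
    have h1 := hgT.comp_measurePreserving measurePreserving_drop
    have h2 := mmseZNoisy_le hf (s := 0) hv hv1 hg (by simpa using! h1)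
    refine h2.trans_eq ?_
    unfold mmseZ
    rw [hm]
    have h3 := integral_map (μ := gauss3) measurePreserving_drop.measurable.aemeasurable
      (f := fun ω : ℝ × ℝ => (ω.1 - g (√(v⁻¹ - 1) * ω.1 + ω.2, f ω.1)) ^ 2)
      (by rw [measurePreserving_drop.map_eq]
          exact (memLp_fst2.sub hgT).integrable_sq.aestronglyMeasurable)
    rw [measurePreserving_drop.map_eq] at h3
    rw [h3]
    simp
  · unfold mmseZ
    rw [← mmseGiven_comp measurePreserving_drop hT memLp_fst2]
    obtain ⟨g, hg, hgT, hm⟩ := exists_estimator memLp_fst3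
      (fun ω : ℝ × ℝ × ℝ => (f (ω.1 + √0 * ω.2.1), (1 - v) * ω.1 + √(v * (1 - v)) * ω.2.2))
    unfold mmseZNoisy
    rw [hm]
    have e : ∀ ω : ℝ × ℝ × ℝ, (f (ω.1 + √0 * ω.2.1), (1 - v) * ω.1 + √(v * (1 - v)) * ω.2.2)
        = (f ω.1, v * √(v⁻¹ - 1) * (√(v⁻¹ - 1) * ω.1 + ω.2.2)) := by
      intro ω
      have e1 : (√(v⁻¹ - 1)) ^ 2 = v⁻¹ - 1 := Real.sq_sqrt (inv_sub_one_nonneg hv hv1)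
      have e2 : v * v⁻¹ = 1 := mul_inv_cancel₀ hv.ne'
      rw [sqrt_mul_one_sub hv]
      ext
      · simp
      · linear_combination (-v * ω.1) * e1 - ω.1 * e2
    simp_rw [e] at hgT ⊢
    exact mmseGiven_le (hT.comp measurePreserving_drop.measurable) memLp_fst3
      (g := fun t => g (t.2, v * √(v⁻¹ - 1) * t.1)) (hg.comp (by fun_prop)) hgT

/-- Additional Gaussian side information: comparison with the best linear estimator. -/
lemma mmseZNoisy_mul_le {f : ℝ → ℝ} (hf : Measurable f) {s v v' : ℝ}
    (hv' : 0 < v') (hvv' : v' < v) (hv1 : v ≤ 1) :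
    mmseZNoisy f s v' * (1 + (v'⁻¹ - v⁻¹) * mmseZNoisy f s v) ≤ mmseZNoisy f s v := by
  have hv : 0 < v := hv'.trans hvv'
  set m := mmseZNoisy f s v with hmdef
  have hm0 : 0 ≤ m := mmseGiven_nonneg
  set h := v'⁻¹ - v⁻¹ with hh
  have hh0 : 0 < h := sub_pos.2 ((inv_lt_inv₀ hv hv').2 hvv')
  set k := √(v⁻¹ - 1) with hk
  set k' := √(v'⁻¹ - 1) with hk'
  set e := √h with he
  have hksq : k ^ 2 = v⁻¹ - 1 := Real.sq_sqrt (inv_sub_one_nonneg hv hv1)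
  have hk'sq : k' ^ 2 = v'⁻¹ - 1 := Real.sq_sqrt (inv_sub_one_nonneg hv' (hvv'.le.trans hv1))
  have hesq : e ^ 2 = h := Real.sq_sqrt hh0.le
  have hk'0 : 0 < k' := Real.sqrt_pos.2 (by
    have := inv_sub_one_nonneg hv hv1
    linarith)
  have hsum : k ^ 2 + e ^ 2 = k' ^ 2 := by rw [hksq, hk'sq, hesq]; ring
  obtain ⟨g, hg, hgT, hgm⟩ := exists_estimator memLp_fst3
    (fun ω : ℝ × ℝ × ℝ => (f (ω.1 + √s * ω.2.1), (1 - v) * ω.1 + √(v * (1 - v)) * ω.2.2))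
  have hgm' : m = ∫ ω : ℝ × ℝ × ℝ, (ω.1 - g (f (ω.1 + √s * ω.2.1),
    (1 - v) * ω.1 + √(v * (1 - v)) * ω.2.2)) ^ 2 ∂gauss3 := hgm
  have hT : Measurable (fun ω : ℝ × ℝ × ℝ =>
      (f (ω.1 + √s * ω.2.1), (1 - v') * ω.1 + √(v' * (1 - v')) * ω.2.2)) := by fun_prop
  have hhm : 0 < 1 + h * m := by positivity
  -- The minimizer of `(1 - c h)² m + c² h`, with minimum `m / (1 + h m)`.
  set c := m / (1 + h * m) with hc
  -- the change of variables between `(N, M)` and `(N₁, N₂)`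
  have hid := MeasurePreserving.id stdGaussian
  have r := measurePreserving_reflection (a := k / k') (b := e / k') (by
    rw [div_pow, div_pow, ← add_div, hsum]; field_simp)
  have p1 : MeasurePreserving (fun x : (ℝ × ℝ × ℝ) × ℝ => (x.1.1, x.1.2.1, x.1.2.2, x.2))
      (gauss3.prod stdGaussian) (stdGaussian.prod gauss3) :=
    (hid.prod (measurePreserving_prodAssoc stdGaussian stdGaussian stdGaussian)).comp
      (measurePreserving_prodAssoc stdGaussian (stdGaussian.prod stdGaussian) stdGaussian)
  have p2 : MeasurePreserving (fun x : ℝ × ℝ × ℝ × ℝ => ((x.1, x.2.1, x.2.2.1), x.2.2.2))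
      (stdGaussian.prod gauss3) (gauss3.prod stdGaussian) := by
    have q1 := (measurePreserving_prodAssoc stdGaussian stdGaussian stdGaussian).symm
    have q2 := (measurePreserving_prodAssoc stdGaussian (stdGaussian.prod stdGaussian)
      stdGaussian).symm
    exact q2.comp (hid.prod q1)
  have p := p2.comp ((hid.prod (hid.prod r)).comp p1)
  -- From the finer observation at `v'` and fresh noise, `y` simulates the observation at `v`. What
  -- remains, `t.1.2 / v' - y`, acts as an independent measurement `h Z + e n₂`, and it corrects the
  -- estimator `g` linearly with gain `c`.
  let gh : (ℝ × ℝ) × ℝ → ℝ := fun t =>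
    let y := (k / k') ^ 2 * (t.1.2 / v') + k * (e / k') * t.2
    g (t.1.1, v * y) * (1 - c * h) + c * (t.1.2 / v' - y)
  have hgh : Measurable gh := by
    have : Measurable fun t : (ℝ × ℝ) × ℝ =>
      g (t.1.1, v * ((k / k') ^ 2 * (t.1.2 / v') + k * (e / k') * t.2)) :=
      hg.comp (by fun_prop)
    simp only [gh]
    fun_prop
  let F : (ℝ × ℝ × ℝ) × ℝ → ℝ := fun x =>
    gh ((f (x.1.1 + √s * x.1.2.1), (1 - v') * x.1.1 + √(v' * (1 - v')) * x.1.2.2), x.2)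
  have hF : Measurable F := hgh.comp (by fun_prop)
  let Θ : (ℝ × ℝ × ℝ) × ℝ → (ℝ × ℝ × ℝ) × ℝ := fun x =>
    ((x.1.1, x.1.2.1, k / k' * x.1.2.2 + e / k' * x.2), e / k' * x.1.2.2 - k / k' * x.2)
  have hΘ : MeasurePreserving Θ (gauss3.prod stdGaussian) (gauss3.prod stdGaussian) := p
  let D : ℝ × ℝ × ℝ → ℝ := fun ω => ω.1 - g (f (ω.1 + √s * ω.2.1),
    (1 - v) * ω.1 + √(v * (1 - v)) * ω.2.2)
  have hD : MemLp D 2 gauss3 := memLp_fst3.sub hgT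
  have v1 : 1 - v = v * k ^ 2 := by rw [hksq]; field_simp
  have v1' : 1 - v' = v' * k' ^ 2 := by rw [hk'sq]; field_simp
  have hFΘ : ∀ x : (ℝ × ℝ × ℝ) × ℝ, x.1.1 - F (Θ x) = (1 - c * h) * D x.1 - c * e * x.2 := by
    rintro ⟨⟨z, w, n⟩, n2⟩
    simp only [F, Θ, gh, D]
    have hy : (k / k') ^ 2 * (((1 - v') * z + √(v' * (1 - v')) * (k / k' * n + e / k' * n2)) / v')
        + k * (e / k') * (e / k' * n - k / k' * n2) = k ^ 2 * z + k * n := by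
      rw [sqrt_mul_one_sub hv', ← hk', v1']
      field_simp
      linear_combination (n * k) * hsum
    have hy' : ((1 - v') * z + √(v' * (1 - v')) * (k / k' * n + e / k' * n2)) / v'
        = k' ^ 2 * z + k * n + e * n2 := by
      rw [sqrt_mul_one_sub hv', ← hk', v1']
      field_simp
      ring
    rw [hy, hy', sqrt_mul_one_sub hv, ← hk, v1]
    have : v * (k ^ 2 * z + k * n) = v * k ^ 2 * z + v * k * n := by ring
    rw [this]
    linear_combination (c * z) * hsum - c * z * hesq
  have hD1 : MemLp (fun x : (ℝ × ℝ × ℝ) × ℝ => D x.1) 2 (gauss3.prod stdGaussian) :=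
    hD.comp_measurePreserving measurePreserving_fst
  have hN1 : MemLp (fun x : (ℝ × ℝ × ℝ) × ℝ => x.2) 2 (gauss3.prod stdGaussian) :=
    memLp_id_std.comp_measurePreserving measurePreserving_snd
  have hZ1 : MemLp (fun x : (ℝ × ℝ × ℝ) × ℝ => x.1.1) 2 (gauss3.prod stdGaussian) :=
    memLp_fst3.comp_measurePreserving measurePreserving_fst
  have hFm : MemLp F 2 (gauss3.prod stdGaussian) := by
    rw [← hΘ.map_eq]
    refine (memLp_map_measure_iff hF.aestronglyMeasurable hΘ.measurable.aemeasurable).2 ?_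
    have h1 := hZ1.sub ((hD1.const_mul (1 - c * h)).sub (hN1.const_mul (c * e)))
    convert! h1 using 1
    ext x
    simp only [Function.comp_apply, Pi.sub_apply]
    linarith [hFΘ x]
  have key := mmseGiven_le_randomized (μ := gauss3) (ν := stdGaussian) hT memLp_fst3 hgh hFm
  have hint : ∫ x : (ℝ × ℝ × ℝ) × ℝ, (x.1.1 - F x) ^ 2 ∂(gauss3.prod stdGaussian)
      = (1 - c * h) ^ 2 * m + c ^ 2 * h := by
    have h3 := integral_map (μ := gauss3.prod stdGaussian) hΘ.measurable.aemeasurable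
      (f := fun x : (ℝ × ℝ × ℝ) × ℝ => (x.1.1 - F x) ^ 2)
      (by rw [hΘ.map_eq]; exact (hZ1.sub hFm).integrable_sq.aestronglyMeasurable)
    rw [hΘ.map_eq] at h3
    rw [h3]
    have h4 : ∀ x, ((Θ x).1.1 - F (Θ x)) ^ 2 = (1 - c * h) ^ 2 * (D x.1) ^ 2
        - (2 * (1 - c * h) * (c * e)) * (D x.1 * x.2) + (c * e) ^ 2 * x.2 ^ 2 := by
      intro x
      have : (Θ x).1.1 = x.1.1 := rfl
      rw [this, hFΘ x]
      ring
    simp_rw [h4]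
    have i1 := hD1.integrable_sq.const_mul ((1 - c * h) ^ 2)
    have i2 : Integrable (fun x : (ℝ × ℝ × ℝ) × ℝ => (2 * (1 - c * h) * (c * e)) * (D x.1 * x.2))
        (gauss3.prod stdGaussian) := (hD1.integrable_mul hN1).const_mul _
    have i3 := hN1.integrable_sq.const_mul ((c * e) ^ 2)
    have i12 : Integrable (fun x : (ℝ × ℝ × ℝ) × ℝ => (1 - c * h) ^ 2 * (D x.1) ^ 2
        - (2 * (1 - c * h) * (c * e)) * (D x.1 * x.2)) (gauss3.prod stdGaussian) := i1.sub i2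
    rw [integral_add i12 i3, integral_sub i1 i2, integral_const_mul, integral_const_mul,
      integral_const_mul, integral_prod_mul D (fun y => y), integral_id_std,
      integral_fun_fst (fun x => D x ^ 2), integral_fun_snd (fun y : ℝ => y ^ 2), integral_sq_std]
    simp only [probReal_univ, one_smul]
    rw [← hgm', mul_pow, hesq]
    ring
  have hle : mmseZNoisy f s v' ≤ (1 - c * h) ^ 2 * m + c ^ 2 * h := key.trans_eq hint
  have hfin : (1 - c * h) ^ 2 * m + c ^ 2 * h = m / (1 + h * m) := by
    rw [hc]
    field_simp
    ring
  rw [hfin, le_div_iff₀ hhm] at hle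
  exact hle

end Gaussian

/-! ### Two-sided bounds for the noisy MMSE in the coordinates `(A, U, Q)`. -/

section Bounds

lemma integral_eq_zero_of_odd {Ω : Type*} [MeasurableSpace Ω] {μ : Measure Ω} {σ : Ω → Ω}
    (hσ : MeasurePreserving σ μ μ) {F : Ω → ℝ} (hF : AEStronglyMeasurable F μ)
    (hodd : ∀ ω, F (σ ω) = -F ω) : ∫ ω, F ω ∂μ = 0 := by
  have h := integral_map (μ := μ) hσ.measurable.aemeasurable (f := F) (by rwa [hσ.map_eq])
  rw [hσ.map_eq] at h
  simp_rw [hodd, integral_neg] at h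
  linarith

lemma measurePreserving_neg_std : MeasurePreserving (fun x : ℝ => -x) stdGaussian stdGaussian :=
  ⟨by fun_prop, by rw [gaussianReal_map_neg, neg_zero]⟩

lemma measurePreserving_neg_snd :
    MeasurePreserving (fun ω : ℝ × ℝ × ℝ => (ω.1, -ω.2.1, ω.2.2)) gauss3 gauss3 :=
  (MeasurePreserving.id stdGaussian).prod
    (measurePreserving_neg_std.prod (MeasurePreserving.id stdGaussian))

lemma measurePreserving_neg_thd :
    MeasurePreserving (fun ω : ℝ × ℝ × ℝ => (ω.1, ω.2.1, -ω.2.2)) gauss3 gauss3 :=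
  (MeasurePreserving.id stdGaussian).prod
    ((MeasurePreserving.id stdGaussian).prod measurePreserving_neg_std)

lemma integral_thd_sq : ∫ ω, ω.2.2 ^ 2 ∂gauss3 = 1 := by
  have h1 := integral_fun_snd (μ := stdGaussian) (ν := stdGaussian.prod stdGaussian)
    (fun x : ℝ × ℝ => x.2 ^ 2)
  have h2 := integral_fun_snd (μ := stdGaussian) (ν := stdGaussian) (fun x : ℝ => x ^ 2)
  simp only [probReal_univ, one_smul, integral_sq_std] at h1 h2
  exact h1.trans h2

lemma integral_snd_sq : ∫ ω, ω.2.1 ^ 2 ∂gauss3 = 1 := by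
  have h1 := integral_fun_snd (μ := stdGaussian) (ν := stdGaussian.prod stdGaussian)
    (fun x : ℝ × ℝ => x.1 ^ 2)
  have h2 := integral_fun_fst (μ := stdGaussian) (ν := stdGaussian) (fun x : ℝ => x ^ 2)
  simp only [probReal_univ, one_smul, integral_sq_std] at h1 h2
  exact h1.trans h2

/-- The region in which the sign of `U` cannot be seen from the observations: the symmetric interval
of radius `√(v + s) |U|` around `√(1 - v) A` is contained in one of the sets `J k`. -/
def blindSet {κ : Type*} (J : κ → Set ℝ) (s v : ℝ) : Set (ℝ × ℝ × ℝ) :=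
  {ω | ∃ k, √(1 - v) * ω.1 - √(v + s) * |ω.2.1| ∈ J k ∧ √(1 - v) * ω.1 + √(v + s) * |ω.2.1| ∈ J k}

lemma measurableSet_blindSet {κ : Type*} [Countable κ] {J : κ → Set ℝ}
    (hJ : ∀ k, (J k).OrdConnected) (s v : ℝ) : MeasurableSet (blindSet J s v) := by
  unfold blindSet
  rw [Set.ofPred_exists]
  refine MeasurableSet.iUnion fun k => MeasurableSet.inter ?_ ?_
  · exact measurableSet_preimage (by fun_prop) (hJ k).measurableSet
  · exact measurableSet_preimage (by fun_prop) (hJ k).measurableSet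

/-- The centre and both shifts by `±√(v + s) U` lie in one interval of constancy. Applied to `U` and
to `-U`, this makes the observation even in `U` on the blind set. -/
lemma blindSet_apply_eq {κ : Type*} {J : κ → Set ℝ} (hJ : ∀ k, (J k).OrdConnected) {f : ℝ → ℝ}
    (hc : ∀ k, ∃ c, ∀ x ∈ J k, f x = c) {s v : ℝ} {ω : ℝ × ℝ × ℝ} (hω : ω ∈ blindSet J s v) :
    f (√(1 - v) * ω.1 + √(v + s) * ω.2.1) = f (√(1 - v) * ω.1) := by
  obtain ⟨k, h1, h2⟩ := hω
  obtain ⟨c, hc⟩ := hc k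
  have hq := Real.sqrt_nonneg (v + s)
  have h3 := mul_le_mul_of_nonneg_left (le_abs_self ω.2.1) hq
  have h4 := mul_le_mul_of_nonneg_left (neg_abs_le ω.2.1) hq
  have h5 := mul_nonneg hq (abs_nonneg ω.2.1)
  rw [hc _ ((hJ k).out h1 h2 ⟨by linarith, by linarith⟩),
    hc _ ((hJ k).out h1 h2 ⟨by linarith, by linarith⟩)]

/-- Lower bound of the noisy MMSE. -/
lemma le_mmseZNoisy {κ : Type*} [Countable κ] {J : κ → Set ℝ}
    (hJ : ∀ k, (J k).OrdConnected) {f : ℝ → ℝ} (hf : Measurable f)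
    (hc : ∀ k, ∃ c, ∀ x ∈ J k, f x = c) {s v : ℝ} (hs : 0 ≤ s) (hv : 0 < v) (hv1 : v ≤ 1) :
    v * (v / (v + s) * (∫ ω, (blindSet J s v).indicator (fun ω => ω.2.1 ^ 2) ω ∂gauss3)
      + s / (v + s)) ≤ mmseZNoisy f s v := by
  rw [mmseZNoisy_eq_coords hf hs hv hv1]
  have hB := measurableSet_blindSet hJ s v
  set B := blindSet J s v with hBdef
  have hBneg : ∀ ω : ℝ × ℝ × ℝ, (ω.1, -ω.2.1, ω.2.2) ∈ B ↔ ω ∈ B := by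
    intro ω; simp [hBdef, blindSet]
  have hBneg' : ∀ ω : ℝ × ℝ × ℝ, (ω.1, ω.2.1, -ω.2.2) ∈ B ↔ ω ∈ B := by
    intro ω; simp [hBdef, blindSet]
  set α := √(v / (v + s)) with hα
  set β := √(s / (v + s)) with hβ
  have e1 : (√v) ^ 2 = v := Real.sq_sqrt hv.le
  have e3 : α ^ 2 = v / (v + s) := Real.sq_sqrt (by positivity)
  have e4 : β ^ 2 = s / (v + s) := Real.sq_sqrt (by positivity)
  let u : ℝ × ℝ × ℝ → ℝ := B.indicator fun ω => ω.2.1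
  have hu : MemLp u 2 gauss3 := memLp_snd3.indicator hB
  have hum : Measurable u := (by fun_prop : Measurable fun ω : ℝ × ℝ × ℝ => ω.2.1).indicator hB
  have huneg : ∀ ω : ℝ × ℝ × ℝ, u (ω.1, -ω.2.1, ω.2.2) = -u ω := by
    intro ω
    by_cases h : ω ∈ B
    · simp [u, h, hBneg]
    · simp [u, h, hBneg]
  have huneg' : ∀ ω : ℝ × ℝ × ℝ, u (ω.1, ω.2.1, -ω.2.2) = u ω := by
    intro ω
    by_cases h : ω ∈ B
    · simp [u, h, hBneg']
    · simp [u, h, hBneg']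
  -- The test function is the part of the signal that the observations cannot see: `U` where its
  -- sign is hidden, and all of `Q`. Flipping the sign of `U`, respectively `Q`, proves
  -- orthogonality to every estimator.
  let h : ℝ × ℝ × ℝ → ℝ := fun ω => √v * (α * u ω + β * ω.2.2)
  have hh : MemLp h 2 gauss3 := ((hu.const_mul _).add (memLp_thd3.const_mul _)).const_mul _
  have horth : ∀ g : ℝ × ℝ → ℝ, Measurable g → MemLp (fun ω => g (obsC f s v ω)) 2 gauss3 →
      ∫ ω, h ω * g (obsC f s v ω) ∂gauss3 = 0 := by
    intro g hg hgT
    have i1 : Integrable (fun ω => u ω * g (obsC f s v ω)) gauss3 := hu.integrable_mul hgT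
    have i2 : Integrable (fun ω => ω.2.2 * g (obsC f s v ω)) gauss3 :=
      memLp_thd3.integrable_mul hgT
    have z1 : ∫ ω, u ω * g (obsC f s v ω) ∂gauss3 = 0 := by
      refine integral_eq_zero_of_odd measurePreserving_neg_snd i1.aestronglyMeasurable fun ω => ?_
      rw [huneg]
      by_cases hω : ω ∈ B
      · have h1 := blindSet_apply_eq hJ hc hω
        have h2 := blindSet_apply_eq hJ hc ((hBneg ω).2 hω)
        have : obsC f s v (ω.1, -ω.2.1, ω.2.2) = obsC f s v ω := by
          unfold obsC
          rw [h1]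
          exact Prod.ext h2 rfl
        rw [this]
        ring
      · simp [u, hω]
    have z2 : ∫ ω, ω.2.2 * g (obsC f s v ω) ∂gauss3 = 0 := by
      refine integral_eq_zero_of_odd measurePreserving_neg_thd i2.aestronglyMeasurable fun ω => ?_
      have : obsC f s v (ω.1, ω.2.1, -ω.2.2) = obsC f s v ω := rfl
      rw [this]
      ring
    have : ∀ ω, h ω * g (obsC f s v ω) = (√v * α) * (u ω * g (obsC f s v ω))
        + (√v * β) * (ω.2.2 * g (obsC f s v ω)) := by
      intro ω; simp only [h]; ring
    simp_rw [this]
    rw [integral_add (i1.const_mul _) (i2.const_mul _), integral_const_mul, integral_const_mul,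
      z1, z2]
    ring
  refine le_of_eq_of_le ?_ (le_mmseGiven (memLp_sigC s v) hh horth)
  have zR : ∫ ω, h ω * (√(1 - v) * ω.1) ∂gauss3 = 0 :=
    horth (fun t => t.2) measurable_snd (memLp_fst3.const_mul _)
  have iR : Integrable (fun ω => h ω * (√(1 - v) * ω.1)) gauss3 :=
    hh.integrable_mul (memLp_fst3.const_mul _)
  have iZ : Integrable (fun ω => sigC s v ω * h ω) gauss3 := (memLp_sigC s v).integrable_mul hh
  have iU : Integrable (fun ω => B.indicator (fun ω : ℝ × ℝ × ℝ => ω.2.1 ^ 2) ω) gauss3 :=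
    memLp_snd3.integrable_sq.indicator hB
  have iQ := memLp_thd3.integrable_sq
  have iX : Integrable (fun ω => ω.2.1 * ω.2.2) gauss3 := memLp_snd3.integrable_mul memLp_thd3
  have zX : ∫ ω, ω.2.1 * ω.2.2 ∂gauss3 = 0 :=
    integral_eq_zero_of_odd measurePreserving_neg_thd iX.aestronglyMeasurable fun ω => by
      simp
  have hid : ∀ ω, 2 * (sigC s v ω * h ω) - h ω ^ 2
      = 2 * (h ω * (√(1 - v) * ω.1)) + v * (v / (v + s)) * B.indicator (fun ω => ω.2.1 ^ 2) ω
        + v * (s / (v + s)) * ω.2.2 ^ 2 + 2 * v * α * β * (ω.2.1 * ω.2.2) := by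
    intro ω
    have hu2 : u ω * ω.2.1 = B.indicator (fun ω => ω.2.1 ^ 2) ω := by
      by_cases hω : ω ∈ B
      · simp [u, hω, sq]
      · simp [u, hω]
    have hu3 : u ω ^ 2 = B.indicator (fun ω => ω.2.1 ^ 2) ω := by
      by_cases hω : ω ∈ B
      · simp [u, hω]
      · simp [u, hω]
    have hs' : sigC s v ω = √(1 - v) * ω.1 + √v * (α * ω.2.1 + β * ω.2.2) := rfl
    rw [hs']
    simp only [h]
    rw [← e3, ← e4]
    linear_combination (2 * (√v) ^ 2 * α ^ 2) * hu2 - (√v) ^ 2 * α ^ 2 * hu3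
      + (α ^ 2 * B.indicator (fun ω => ω.2.1 ^ 2) ω + β ^ 2 * ω.2.2 ^ 2
        + 2 * α * β * (ω.2.1 * ω.2.2)) * e1
  have j1 := iR.const_mul 2
  have j2 := iU.const_mul (v * (v / (v + s)))
  have j3 := iQ.const_mul (v * (s / (v + s)))
  have j4 := iX.const_mul (2 * v * α * β)
  have hI := integral_congr_ae (μ := gauss3) (Eventually.of_forall hid)
  rw [integral_sub (iZ.const_mul 2) hh.integrable_sq, integral_const_mul,
    integral_add (by simpa using! (j1.add j2).add j3) j4,
    integral_add (by simpa using! j1.add j2) j3, integral_add j1 j2, integral_const_mul,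
    integral_const_mul, integral_const_mul, integral_const_mul, zR, zX, integral_thd_sq] at hI
  rw [hI]
  ring

/-- Upper bound of the noisy MMSE by estimators of `U`. -/
lemma mmseZNoisy_le_of_estimator {f : ℝ → ℝ} (hf : Measurable f) {s v : ℝ} (hs : 0 ≤ s)
    (hv : 0 < v) (hv1 : v ≤ 1) {ψ : ℝ × ℝ → ℝ} (hψ : Measurable ψ) {L : ℝ} (hL : ∀ t, |ψ t| ≤ L) :
    mmseZNoisy f s v ≤ v * (v / (v + s) * (∫ ω, (ω.2.1 - ψ (obsC f s v ω)) ^ 2 ∂gauss3)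
      + s / (v + s)) := by
  rw [mmseZNoisy_eq_coords hf hs hv hv1]
  set α := √(v / (v + s)) with hα
  set β := √(s / (v + s)) with hβ
  have e1 : (√v) ^ 2 = v := Real.sq_sqrt hv.le
  have e3 : α ^ 2 = v / (v + s) := Real.sq_sqrt (by positivity)
  have e4 : β ^ 2 = s / (v + s) := Real.sq_sqrt (by positivity)
  have hT := measurable_obsC hf s v
  have hψT : MemLp (fun ω => ψ (obsC f s v ω)) 2 gauss3 :=
    MemLp.of_bound (hψ.comp hT).aestronglyMeasurable L (Eventually.of_forall fun ω => hL _)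
  have hgT : MemLp (fun ω => (fun t : ℝ × ℝ => t.2 + √v * α * ψ t) (obsC f s v ω)) 2 gauss3 :=
    (memLp_fst3.const_mul (√(1 - v))).add (hψT.const_mul (√v * α))
  refine (mmseGiven_le hT (memLp_sigC s v)
    (g := fun t : ℝ × ℝ => t.2 + √v * α * ψ t) (by fun_prop) hgT).trans_eq ?_
  have hE : MemLp (fun ω : ℝ × ℝ × ℝ => ω.2.1 - ψ (obsC f s v ω)) 2 gauss3 :=
    memLp_snd3.sub hψT
  have iX : Integrable (fun ω : ℝ × ℝ × ℝ => (ω.2.1 - ψ (obsC f s v ω)) * ω.2.2) gauss3 :=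
    hE.integrable_mul memLp_thd3
  have zX : ∫ ω, (ω.2.1 - ψ (obsC f s v ω)) * ω.2.2 ∂gauss3 = 0 :=
    integral_eq_zero_of_odd measurePreserving_neg_thd iX.aestronglyMeasurable fun ω => by
      have : obsC f s v (ω.1, ω.2.1, -ω.2.2) = obsC f s v ω := rfl
      rw [this]
      ring
  have hid : ∀ ω, (sigC s v ω - ((obsC f s v ω).2 + √v * α * ψ (obsC f s v ω))) ^ 2
      = v * (v / (v + s)) * (ω.2.1 - ψ (obsC f s v ω)) ^ 2 + v * (s / (v + s)) * ω.2.2 ^ 2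
        + 2 * v * α * β * ((ω.2.1 - ψ (obsC f s v ω)) * ω.2.2) := by
    intro ω
    have hs' : sigC s v ω - ((obsC f s v ω).2 + √v * α * ψ (obsC f s v ω))
        = √v * (α * (ω.2.1 - ψ (obsC f s v ω)) + β * ω.2.2) := by
      simp only [sigC, obsC, hα, hβ]; ring
    rw [hs', mul_pow, e1, ← e3, ← e4]
    ring
  simp_rw [hid]
  have j1 := hE.integrable_sq.const_mul (v * (v / (v + s)))
  have j2 := memLp_thd3.integrable_sq.const_mul (v * (s / (v + s)))
  have j3 := iX.const_mul (2 * v * α * β)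
  rw [integral_add (by simpa using! j1.add j2) j3, integral_add j1 j2, integral_const_mul,
    integral_const_mul, integral_const_mul, zX, integral_thd_sq]
  ring

/-- The zero estimator of `U` leaves the full residual variance `v`. -/
lemma mmseZNoisy_le_self {f : ℝ → ℝ} (hf : Measurable f) {s v : ℝ} (hs : 0 ≤ s)
    (hv : 0 < v) (hv1 : v ≤ 1) : mmseZNoisy f s v ≤ v := by
  have h := mmseZNoisy_le_of_estimator hf hs hv hv1 (ψ := fun _ => 0) measurable_const (L := 0)
    (by simp)
  simp only [sub_zero, integral_snd_sq, mul_one] at h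
  refine h.trans_eq ?_
  have : v + s ≠ 0 := by positivity
  field_simp

/-- The unseen `Q` alone contributes this error, whatever `f` is. An empty family of intervals makes
the blind set empty. -/
lemma mul_div_add_le_mmseZNoisy {f : ℝ → ℝ} (hf : Measurable f) {s v : ℝ} (hs : 0 ≤ s)
    (hv : 0 < v) (hv1 : v ≤ 1) : v * (s / (v + s)) ≤ mmseZNoisy f s v := by
  have h := le_mmseZNoisy (κ := Empty) (J := fun _ => ∅) (by simp) hf (by simp) hs hv hv1
  refine le_trans ?_ h
  have : 0 ≤ ∫ ω, (blindSet (fun _ : Empty => ∅) s v).indicator (fun ω => ω.2.1 ^ 2) ω ∂gauss3 :=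
    integral_nonneg fun ω => Set.indicator_nonneg (fun ω _ => sq_nonneg _) ω
  have h2 : 0 ≤ v / (v + s) := by positivity
  gcongr
  have := mul_nonneg h2 this
  linarith

end Bounds

/-! ### Measure theory of the piecewise decomposition. -/

section Pieces

/-- A decomposition of the line into finitely many intervals, on each of which `f` is continuous and
either injective or constant. -/
structure Pieces (f : ℝ → ℝ) where
  K : ℕ
  I : Fin K → Set ℝ
  ord : ∀ k, (I k).OrdConnected
  disj : Pairwise fun j k => Disjoint (I j) (I k)
  cover : ⋃ k, I k = Set.univ
  cont : ∀ k, ContinuousOn f (I k)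
  dich : ∀ k, Set.InjOn f (I k) ∨ ∃ c, ∀ x ∈ I k, f x = c

lemma PiecewiseSmooth.nonempty_pieces {f : ℝ → ℝ} (hf : PiecewiseSmooth f) :
    Nonempty (Pieces f) := by
  obtain ⟨⟨K, I, h1, h2, h3, h4⟩, -⟩ := hf
  refine ⟨⟨K, I, h1, h2, h3, fun k => (h4 k).1.continuousOn, fun k => ?_⟩⟩
  rcases (h4 k).2 with h | h | h
  · exact Or.inl h.injOn
  · exact Or.inl h.injOn
  · exact Or.inr h

namespace Pieces

variable {f : ℝ → ℝ}

lemma measurable (D : Pieces f) : Measurable f := by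
  intro t ht
  have : f ⁻¹' t = ⋃ k, Subtype.val '' ((D.I k).domRestrict f ⁻¹' t) := by
    ext x
    have hx : x ∈ ⋃ k, D.I k := by rw [D.cover]; trivial
    obtain ⟨k, hk⟩ := Set.mem_iUnion.1 hx
    simp only [Set.mem_preimage, Set.mem_iUnion, Set.mem_image]
    constructor
    · intro h
      exact ⟨k, ⟨x, hk⟩, h, rfl⟩
    · rintro ⟨j, ⟨y, hy⟩, h, rfl⟩
      exact h
  rw [this]
  refine MeasurableSet.iUnion fun k => (D.ord k).measurableSet.subtype_image ?_
  exact (continuousOn_iff_continuous_domRestrict.1 (D.cont k)).measurable ht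

/-- The union of the pieces on which `f` is injective. -/
def injSet (D : Pieces f) : Set ℝ := ⋃ k ∈ {k | Set.InjOn f (D.I k)}, D.I k

lemma measurableSet_injSet (D : Pieces f) : MeasurableSet D.injSet :=
  MeasurableSet.biUnion (Set.to_countable _) fun k _ => (D.ord k).measurableSet

/-- The Gaussian measure of the union of the pieces on which `f` is injective. -/
noncomputable def p (D : Pieces f) : ℝ := stdGaussian.real D.injSet

lemma p_nonneg (D : Pieces f) : 0 ≤ D.p := measureReal_nonneg

/-- Frontiers of convex sets are Lebesgue null. -/
lemma ae_mem_interior (D : Pieces f) : ∀ᵐ x ∂stdGaussian, ∃ k, x ∈ interior (D.I k) := by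
  have h : ∀ᵐ x ∂stdGaussian, ∀ k, x ∉ frontier (D.I k) := by
    rw [ae_all_iff]
    intro k
    have h0 : stdGaussian (frontier (D.I k)) = 0 :=
      gaussianReal_absolutelyContinuous 0 one_ne_zero
        ((D.ord k).convex.addHaar_frontier volume)
    exact measure_eq_zero_iff_ae_notMem.1 h0
  filter_upwards [h] with x hx
  have hx' : x ∈ ⋃ k, D.I k := by rw [D.cover]; trivial
  obtain ⟨k, hk⟩ := Set.mem_iUnion.1 hx'
  exact ⟨k, by_contra fun hi => hx k ⟨subset_closure hk, hi⟩⟩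

lemma ae_continuousAt (D : Pieces f) : ∀ᵐ x ∂stdGaussian, ContinuousAt f x := by
  filter_upwards [D.ae_mem_interior] with x ⟨k, hk⟩
  exact (D.cont k).continuousAt (mem_interior_iff_mem_nhds.1 hk)

lemma eq_of_mem (D : Pieces f) {x : ℝ} {j k : Fin D.K} (hj : x ∈ D.I j) (hk : x ∈ D.I k) : j = k := by
  by_contra h
  exact Set.disjoint_left.1 (D.disj h) hj hk

lemma mem_injSet_iff (D : Pieces f) {x : ℝ} {k : Fin D.K} (hk : x ∈ D.I k) :
    x ∈ D.injSet ↔ Set.InjOn f (D.I k) := by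
  simp only [injSet, Set.mem_iUnion, Set.mem_ofPred_eq]
  constructor
  · rintro ⟨j, hj, hx⟩
    rwa [D.eq_of_mem hk hx]
  · intro h
    exact ⟨k, h, hk⟩

/-- The pieces on which `f` is not injective, hence constant. -/
def J (D : Pieces f) (k : {k : Fin D.K // ¬ Set.InjOn f (D.I k)}) : Set ℝ := D.I k.1

lemma J_const (D : Pieces f) (k : {k : Fin D.K // ¬ Set.InjOn f (D.I k)}) : ∃ c, ∀ x ∈ D.J k, f x = c :=
  (D.dich k.1).resolve_left k.2

/-- Lusin–Souslin: an injective measurable map on a standard Borel space is a measurable embedding,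
so its inverse extends measurably to the line. -/
lemma exists_leftInverse (D : Pieces f) (k : Fin D.K) (hk : Set.InjOn f (D.I k)) :
    ∃ g : ℝ → ℝ, Measurable g ∧ ∀ x ∈ D.I k, g (f x) = x := by
  have : StandardBorelSpace (D.I k) := (D.ord k).measurableSet.standardBorel
  have hm : MeasurableEmbedding ((D.I k).domRestrict f) :=
    Measurable.measurableEmbedding (D.measurable.comp measurable_subtype_coe) hk.injective
  obtain ⟨g, hg, hgf⟩ := hm.exists_measurable_extend measurable_subtype_coe fun _ => ⟨0⟩
  exact ⟨g, hg, fun x hx => congrFun hgf ⟨x, hx⟩⟩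

end Pieces

end Pieces

/-! ### Asymptotics of the MMSE at the origin, and semicontinuity at vanishing noise. -/

section Limits

/-- The admissible pairs `(v, s)`. -/
def dom : Set (ℝ × ℝ) := {x | 0 < x.1 ∧ x.1 ≤ 1 ∧ 0 ≤ x.2}

lemma integral_prod_fst_snd (a b : ℝ → ℝ) :
    ∫ ω, a ω.1 * b ω.2.1 ∂gauss3 = (∫ x, a x ∂stdGaussian) * ∫ x, b x ∂stdGaussian := by
  have h := integral_prod_mul (μ := stdGaussian) (ν := stdGaussian.prod stdGaussian) a
    (fun x : ℝ × ℝ => b x.1)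
  have h2 := integral_fun_fst (μ := stdGaussian) (ν := stdGaussian) b
  simp only [probReal_univ, one_smul] at h2
  rw [← h2, ← h]

lemma integral_indicator_one_std {s : Set ℝ} (hs : MeasurableSet s) :
    ∫ x, s.indicator (fun _ => (1 : ℝ)) x ∂stdGaussian = stdGaussian.real s := by
  rw [integral_indicator hs]; simp

/-- Truncation to `[-L, L]`. -/
noncomputable def clamp (L x : ℝ) : ℝ := max (-L) (min x L)

lemma abs_clamp_le {L : ℝ} (hL : 0 ≤ L) (x : ℝ) : |clamp L x| ≤ L := by
  unfold clamp
  rw [abs_le]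
  exact ⟨le_max_left _ _, max_le (by linarith) (min_le_right _ _)⟩

lemma clamp_eq_self {L x : ℝ} (h : |x| ≤ L) : clamp L x = x := by
  rw [abs_le] at h
  rw [clamp, min_eq_left h.2, max_eq_right h.1]

@[fun_prop]
lemma measurable_clamp (L : ℝ) : Measurable (clamp L) := by unfold clamp; fun_prop

lemma integrable_sq_std : Integrable (fun x : ℝ => x ^ 2) stdGaussian := memLp_id_std.integrable_sq

lemma tendsto_truncation_error :
    Tendsto (fun n : ℕ => ∫ x, (x - clamp n x) ^ 2 ∂stdGaussian) atTop (𝓝 0) := by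
  rw [← integral_zero ℝ ℝ (μ := stdGaussian)]
  refine tendsto_integral_of_dominated_convergence (fun x => x ^ 2) ?_ integrable_sq_std ?_ ?_
  · intro n
    exact (by fun_prop : Measurable fun x : ℝ => (x - clamp n x) ^ 2).aestronglyMeasurable
  · intro n
    refine Eventually.of_forall fun x => ?_
    rw [Real.norm_eq_abs, abs_of_nonneg (sq_nonneg _)]
    rcases le_or_gt |x| n with h | h
    · rw [clamp_eq_self h]
      simpa using sq_nonneg x
    · have hn : (0 : ℝ) ≤ n := n.cast_nonneg
      rcases le_total 0 x with h0 | h0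
      · rw [abs_of_nonneg h0] at h
        rw [clamp, min_eq_right h.le, max_eq_right (by linarith)]
        nlinarith
      · rw [abs_of_nonpos h0] at h
        rw [clamp, min_eq_left (by linarith), max_eq_left (by linarith)]
        nlinarith
  · refine Eventually.of_forall fun x => ?_
    refine tendsto_const_nhds.congr' ?_
    filter_upwards [eventually_ge_atTop ⌈|x|⌉₊] with n hn
    rw [clamp_eq_self (Nat.ceil_le.1 hn)]
    ring

namespace Pieces

variable {f : ℝ → ℝ}

lemma eventually_mem_piece (D : Pieces f) {a : ℝ} {k : Fin D.K} (ha : a ∈ interior (D.I k))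
    (u : ℝ) : ∀ᶠ x : ℝ × ℝ in 𝓝[dom] (0, 0), √(1 - x.1) * a + √(x.1 + x.2) * u ∈ D.I k := by
  have hc : ContinuousAt (fun x : ℝ × ℝ => √(1 - x.1) * a + √(x.1 + x.2) * u) (0, 0) := by
    fun_prop
  refine (hc.mono_left nhdsWithin_le_nhds).eventually ?_
  simpa using mem_interior_iff_mem_nhds.1 ha

/-- For almost every `A` the shrinking window around `√(1 - v) A` ends up inside the piece
containing `A`. Blindness then just means that this piece is not injective, and dominated
convergence applies. -/
lemma tendsto_blind (D : Pieces f) :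
    Tendsto (fun x : ℝ × ℝ =>
      ∫ ω, (blindSet D.J x.2 x.1).indicator (fun ω => ω.2.1 ^ 2) ω ∂gauss3)
      (𝓝[dom] (0, 0)) (𝓝 (1 - D.p)) := by
  have hlim : ∫ ω, D.injSetᶜ.indicator (fun _ => (1 : ℝ)) ω.1 * ω.2.1 ^ 2 ∂gauss3 = 1 - D.p := by
    have := integral_prod_fst_snd (D.injSetᶜ.indicator (fun _ => (1 : ℝ))) (fun x => x ^ 2)
    rw [integral_indicator_one_std D.measurableSet_injSet.compl, integral_sq_std, mul_one,
      probReal_compl_eq_one_sub D.measurableSet_injSet] at this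
    exact this
  rw [← hlim]
  refine tendsto_integral_filter_of_dominated_convergence (fun ω => ω.2.1 ^ 2) ?_ ?_
    memLp_snd3.integrable_sq ?_
  · refine Eventually.of_forall fun x => ?_
    exact ((by fun_prop : Measurable fun ω : ℝ × ℝ × ℝ => ω.2.1 ^ 2).indicator
      (measurableSet_blindSet (J := D.J) (fun k => D.ord k.1) _ _)).aestronglyMeasurable
  · refine Eventually.of_forall fun x => Eventually.of_forall fun ω => ?_
    refine (norm_indicator_le_norm_self _ _).trans_eq ?_
    rw [Real.norm_eq_abs, abs_of_nonneg (sq_nonneg _)]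
  · have hae : ∀ᵐ ω ∂gauss3, ∃ k, ω.1 ∈ interior (D.I k) :=
      (measurePreserving_fst (μ := stdGaussian)
        (ν := stdGaussian.prod stdGaussian)).quasiMeasurePreserving.ae D.ae_mem_interior
    filter_upwards [hae] with ω ⟨k, hk⟩
    have e1 := D.eventually_mem_piece hk |ω.2.1|
    have e2 := D.eventually_mem_piece hk (-|ω.2.1|)
    refine tendsto_const_nhds.congr' ?_
    have hinj := D.mem_injSet_iff (interior_subset hk)
    filter_upwards [e1, e2] with x h1 h2
    have h2' : √(1 - x.1) * ω.1 - √(x.1 + x.2) * |ω.2.1| ∈ D.I k := by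
      rwa [mul_neg, ← sub_eq_add_neg] at h2
    by_cases h : Set.InjOn f (D.I k)
    · have : ω ∉ blindSet D.J x.2 x.1 := by
        rintro ⟨j, hj, -⟩
        exact j.2 (D.eq_of_mem h2' hj ▸ h)
      rw [Set.indicator_of_notMem this, Set.indicator_of_notMem (by simpa using hinj.2 h), zero_mul]
    · have : ω ∈ blindSet D.J x.2 x.1 := ⟨⟨k, h⟩, h2', h1⟩
      rw [Set.indicator_of_mem this, Set.indicator_of_mem (by simpa using fun h' => h (hinj.1 h')),
        one_mul]

/-- The side information names the piece. If it is injective, invert `f` there, subtract the side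
information and rescale to recover `U`; otherwise answer `0`. Clamping at `L` controls the cases
where the point has left the piece and provides the domination. The bound `D.K * L` counts every
summand, although at most one is nonzero. -/
lemma exists_estimator_family (D : Pieces f) {L : ℝ} (hL : 0 ≤ L) :
    ∃ ψ : ℝ × ℝ → ℝ × ℝ → ℝ, (∀ x, Measurable (ψ x)) ∧ (∀ x t, |ψ x t| ≤ D.K * L) ∧
      Tendsto (fun x : ℝ × ℝ => ∫ ω, (ω.2.1 - ψ x (obsC f x.2 x.1 ω)) ^ 2 ∂gauss3)
        (𝓝[dom] (0, 0)) (𝓝 (D.p * (∫ x, (x - clamp L x) ^ 2 ∂stdGaussian) + (1 - D.p))) := by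
  classical
  have hg : ∀ k, ∃ g : ℝ → ℝ, Measurable g ∧ (Set.InjOn f (D.I k) → ∀ x ∈ D.I k, g (f x) = x) := by
    intro k
    by_cases h : Set.InjOn f (D.I k)
    · obtain ⟨g, hg, hgf⟩ := D.exists_leftInverse k h
      exact ⟨g, hg, fun _ => hgf⟩
    · exact ⟨id, measurable_id, fun h' => absurd h' h⟩
  choose g hg hgf using hg
  let ψ : ℝ × ℝ → ℝ × ℝ → ℝ := fun x t => ∑ k with Set.InjOn f (D.I k),
    (Prod.snd ⁻¹' D.I k).indicator (fun t : ℝ × ℝ => clamp L ((g k t.1 - t.2) / √(x.1 + x.2))) t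
  have hψm : ∀ x, Measurable (ψ x) := by
    intro x
    refine Finset.measurable_sum _ fun k _ => Measurable.indicator ?_
      (measurable_snd (D.ord k).measurableSet)
    have := hg k
    fun_prop
  have hψb : ∀ x t, |ψ x t| ≤ D.K * L := by
    intro x t
    refine (Finset.abs_sum_le_sum_abs _ _).trans ?_
    refine (Finset.sum_le_card_nsmul _ _ L fun k _ => ?_).trans ?_
    · by_cases h : t ∈ Prod.snd ⁻¹' D.I k
      · rw [Set.indicator_of_mem h]
        exact abs_clamp_le hL _
      · rw [Set.indicator_of_notMem h, abs_zero]
        exact hL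
    · rw [nsmul_eq_mul]
      gcongr
      exact (Finset.card_filter_le _ _).trans (by simp)
  refine ⟨ψ, hψm, hψb, ?_⟩
  have i1 : Integrable (fun ω : ℝ × ℝ × ℝ => D.injSet.indicator (fun _ => (1 : ℝ)) ω.1
      * (ω.2.1 - clamp L ω.2.1) ^ 2) gauss3 := by
    have hc : MemLp (fun ω : ℝ × ℝ × ℝ => ω.2.1 - clamp L ω.2.1) 2 gauss3 :=
      memLp_snd3.sub (MemLp.of_bound (by fun_prop : Measurable fun ω : ℝ × ℝ × ℝ =>
        clamp L ω.2.1).aestronglyMeasurable L (Eventually.of_forall fun ω => abs_clamp_le hL _))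
    refine hc.integrable_sq.bdd_mul (c := 1) ?_ (Eventually.of_forall fun ω => ?_)
    · exact ((measurable_const.indicator D.measurableSet_injSet).comp
        measurable_fst).aestronglyMeasurable
    · exact (norm_indicator_le_norm_self _ _).trans (by simp)
  have i2 : Integrable (fun ω : ℝ × ℝ × ℝ => D.injSetᶜ.indicator (fun _ => (1 : ℝ)) ω.1
      * ω.2.1 ^ 2) gauss3 := by
    refine memLp_snd3.integrable_sq.bdd_mul (c := 1) ?_ (Eventually.of_forall fun ω => ?_)
    · exact ((measurable_const.indicator D.measurableSet_injSet.compl).comp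
        measurable_fst).aestronglyMeasurable
    · exact (norm_indicator_le_norm_self _ _).trans (by simp)
  have hlim : ∫ ω, (D.injSet.indicator (fun _ => (1 : ℝ)) ω.1 * (ω.2.1 - clamp L ω.2.1) ^ 2
      + D.injSetᶜ.indicator (fun _ => (1 : ℝ)) ω.1 * ω.2.1 ^ 2) ∂gauss3
      = D.p * (∫ x, (x - clamp L x) ^ 2 ∂stdGaussian) + (1 - D.p) := by
    rw [integral_add i1 i2, integral_prod_fst_snd (D.injSet.indicator (fun _ => (1 : ℝ)))
      (fun x => (x - clamp L x) ^ 2), integral_prod_fst_snd (D.injSetᶜ.indicator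
      (fun _ => (1 : ℝ))) (fun x => x ^ 2), integral_indicator_one_std D.measurableSet_injSet,
      integral_indicator_one_std D.measurableSet_injSet.compl, integral_sq_std, mul_one,
      probReal_compl_eq_one_sub D.measurableSet_injSet]
    rfl
  rw [← hlim]
  have hbd : MemLp (fun ω : ℝ × ℝ × ℝ => |ω.2.1| + D.K * L) 2 gauss3 :=
    memLp_snd3.norm.add (memLp_const _)
  refine tendsto_integral_filter_of_dominated_convergence
    (fun ω => (|ω.2.1| + D.K * L) ^ 2) ?_ ?_ hbd.integrable_sq ?_
  · refine Eventually.of_forall fun x => Measurable.aestronglyMeasurable ?_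
    have h1 : Measurable fun ω => ψ x (obsC f x.2 x.1 ω) :=
      (hψm x).comp (measurable_obsC D.measurable _ _)
    exact ((by fun_prop : Measurable fun ω : ℝ × ℝ × ℝ => ω.2.1).sub h1).pow_const 2
  · refine Eventually.of_forall fun x => Eventually.of_forall fun ω => ?_
    rw [Real.norm_eq_abs, abs_of_nonneg (sq_nonneg _)]
    refine sq_le_sq.2 ?_
    rw [abs_of_nonneg (by positivity : 0 ≤ |ω.2.1| + D.K * L)]
    exact (abs_sub _ _).trans (by gcongr; exact hψb _ _)
  · have hae : ∀ᵐ ω ∂gauss3, ∃ k, ω.1 ∈ interior (D.I k) :=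
      (measurePreserving_fst (μ := stdGaussian)
        (ν := stdGaussian.prod stdGaussian)).quasiMeasurePreserving.ae D.ae_mem_interior
    filter_upwards [hae] with ω ⟨k, hk⟩
    have e1 := D.eventually_mem_piece hk ω.2.1
    have e2 := D.eventually_mem_piece hk 0
    refine tendsto_const_nhds.congr' ?_
    have hinj := D.mem_injSet_iff (interior_subset hk)
    filter_upwards [e1, e2, self_mem_nhdsWithin] with x h1 h2 hx
    rw [mul_zero, add_zero] at h2
    have hpos : 0 < √(x.1 + x.2) := Real.sqrt_pos.2 (by linarith [hx.1, hx.2.2])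
    by_cases h : Set.InjOn f (D.I k)
    · have hψ : ψ x (obsC f x.2 x.1 ω) = clamp L ω.2.1 := by
        simp only [ψ]
        rw [Finset.sum_eq_single_of_mem k (by simpa using h)]
        · rw [Set.indicator_of_mem (by exact h2)]
          simp only [obsC]
          rw [hgf k h _ h1]
          congr 1
          field_simp
          ring
        · intro j _ hjk
          refine Set.indicator_of_notMem (fun hj => hjk ?_) _
          exact D.eq_of_mem hj h2
      rw [hψ, Set.indicator_of_mem (hinj.2 h), Set.indicator_of_notMem (by simpa using hinj.2 h)]
      ring
    · have hψ : ψ x (obsC f x.2 x.1 ω) = 0 := by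
        simp only [ψ]
        refine Finset.sum_eq_zero fun j hj => Set.indicator_of_notMem (fun hj' => h ?_) _
        have : j = k := D.eq_of_mem hj' h2
        rw [← this]
        simpa using hj
      have h' : ω.1 ∉ D.injSet := fun h' => h (hinj.1 h')
      rw [hψ, Set.indicator_of_notMem h', Set.indicator_of_mem (by simpa using h')]
      ring

/-- The noisy MMSE near the origin. -/
lemma tendsto_ratio (D : Pieces f) :
    Tendsto (fun x : ℝ × ℝ => mmseZNoisy f x.2 x.1 / x.1 - (1 - D.p * (x.1 / (x.1 + x.2))))
      (𝓝[dom] (0, 0)) (𝓝 0) := by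
  rw [Metric.tendsto_nhds]
  intro η hη
  -- The truncation level is fixed before `(v, s)` moves. Half of `η` pays for it, which leaves a
  -- strict margin for the limit of the estimator errors.
  have hτ := (tendsto_truncation_error.const_mul D.p).eventually
    (gt_mem_nhds (show D.p * 0 < η / 2 by rw [mul_zero]; positivity))
  obtain ⟨n, hn⟩ := hτ.exists
  obtain ⟨ψ, hψm, hψb, hψ⟩ := D.exists_estimator_family (L := n) n.cast_nonneg
  have hup := hψ.eventually (gt_mem_nhds (show _ < (1 - D.p) + η / 2 by linarith))
  have hlo := D.tendsto_blind.eventually (lt_mem_nhds (show (1 - D.p) - η / 2 < 1 - D.p by linarith))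
  filter_upwards [hup, hlo, self_mem_nhdsWithin] with x hup hlo ⟨hv, hv1, hs⟩
  have b1 := mmseZNoisy_le_of_estimator D.measurable hs hv hv1 (hψm x) (hψb x)
  have b2 := le_mmseZNoisy (J := D.J) (fun k => D.ord k.1) D.measurable D.J_const hs hv hv1
  set E := ∫ ω, (ω.2.1 - ψ x (obsC f x.2 x.1 ω)) ^ 2 ∂gauss3
  set b := ∫ ω, (blindSet D.J x.2 x.1).indicator (fun ω => ω.2.1 ^ 2) ω ∂gauss3
  set θ := x.1 / (x.1 + x.2) with hθ
  have hsum : 0 < x.1 + x.2 := by linarith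
  have hθ0 : 0 ≤ θ := by positivity
  have hθ1 : θ ≤ 1 := (div_le_one hsum).2 (by linarith)
  have hθ' : x.2 / (x.1 + x.2) = 1 - θ := by rw [hθ]; field_simp; ring
  rw [hθ'] at b1 b2
  have b1' : mmseZNoisy f x.2 x.1 / x.1 ≤ θ * E + (1 - θ) := by
    rw [div_le_iff₀ hv]; linarith
  have b2' : θ * b + (1 - θ) ≤ mmseZNoisy f x.2 x.1 / x.1 := by
    rw [le_div_iff₀ hv]; linarith
  rw [Real.dist_eq, sub_zero, abs_lt]
  constructor
  · nlinarith
  · nlinarith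

/-- Upper semicontinuity of the MMSE in the noise level. -/
lemma eventually_mmseZNoisy_lt (D : Pieces f) {v₀ c : ℝ} (hv₀ : 0 < v₀)
    (hc : mmseZ f v₀ < c) : ∀ᶠ x : ℝ × ℝ in 𝓝[dom] (v₀, 0), mmseZNoisy f x.2 x.1 < c := by
  have hf := D.measurable
  have hT : Measurable (fun ω : ℝ × ℝ => (√(v₀⁻¹ - 1) * ω.1 + ω.2, f ω.1)) := by fun_prop
  obtain ⟨g, hg, hgT, hm⟩ := exists_estimator memLp_fst2
    (fun ω : ℝ × ℝ => (√(v₀⁻¹ - 1) * ω.1 + ω.2, f ω.1))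
  have hm' : mmseZ f v₀ = ∫ ω : ℝ × ℝ, (ω.1 - g (√(v₀⁻¹ - 1) * ω.1 + ω.2, f ω.1)) ^ 2
    ∂(stdGaussian.prod stdGaussian) := hm
  set m := mmseZ f v₀ with hmdef
  have hm0 : 0 ≤ m := mmseGiven_nonneg
  -- The optimal `g` is only measurable, so it is replaced by a bounded continuous `G`. The cost is
  -- controlled by `(a + b)² ≤ (1 + t) a² + (1 + t⁻¹) b²`: here `t` keeps the first term below `c`,
  -- and `ε` below spends half of the remaining slack.
  obtain ⟨t, ht0, ht⟩ : ∃ t : ℝ, 0 < t ∧ (1 + t) * m < c := by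
    refine ⟨(c - m) / (2 * (m + 1)), by have := sub_pos.2 hc; positivity, ?_⟩
    have : (c - m) / (2 * (m + 1)) * m ≤ (c - m) / 2 := by
      rw [div_mul_eq_mul_div, div_le_div_iff₀ (by positivity) (by positivity)]
      nlinarith [sub_pos.2 hc]
    linarith [sub_pos.2 hc]
  set ε := (c - (1 + t) * m) / (2 * (1 + t⁻¹)) with hε
  have hε0 : 0 < ε := by have := sub_pos.2 ht; positivity
  let ν := (stdGaussian.prod stdGaussian).map
    (fun ω : ℝ × ℝ => (√(v₀⁻¹ - 1) * ω.1 + ω.2, f ω.1))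
  have : IsProbabilityMeasure ν := Measure.isProbabilityMeasure_map hT.aemeasurable
  have hgν : MemLp g (ENNReal.ofReal 2) ν := by
    rw [ENNReal.ofReal_ofNat]
    exact (memLp_map_measure_iff hg.aestronglyMeasurable hT.aemeasurable).2 hgT
  obtain ⟨G, hG, hGm⟩ := hgν.exists_boundedContinuous_integral_rpow_sub_le two_pos hε0
  have hGcont : Continuous G := G.continuous
  rw [integral_map hT.aemeasurable (Measurable.aestronglyMeasurable (by fun_prop))] at hG
  simp only [Real.norm_eq_abs, Real.rpow_two, sq_abs] at hG
  have hGT : MemLp (fun ω : ℝ × ℝ => G (√(v₀⁻¹ - 1) * ω.1 + ω.2, f ω.1)) 2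
      (stdGaussian.prod stdGaussian) :=
    MemLp.of_bound (hGcont.measurable.comp hT).aestronglyMeasurable ‖G‖
      (Eventually.of_forall fun ω => G.norm_coe_le_norm _)
  have hlt : ∫ ω : ℝ × ℝ, (ω.1 - G (√(v₀⁻¹ - 1) * ω.1 + ω.2, f ω.1)) ^ 2
      ∂(stdGaussian.prod stdGaussian) < c := by
    have i1 : Integrable (fun ω : ℝ × ℝ => (1 + t) *
        (ω.1 - g (√(v₀⁻¹ - 1) * ω.1 + ω.2, f ω.1)) ^ 2) (stdGaussian.prod stdGaussian) :=
      (memLp_fst2.sub hgT).integrable_sq.const_mul (1 + t)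
    have i2 : Integrable (fun ω : ℝ × ℝ => (1 + t⁻¹) * (g (√(v₀⁻¹ - 1) * ω.1 + ω.2, f ω.1)
        - G (√(v₀⁻¹ - 1) * ω.1 + ω.2, f ω.1)) ^ 2) (stdGaussian.prod stdGaussian) :=
      (hgT.sub hGT).integrable_sq.const_mul (1 + t⁻¹)
    have hle : ∫ ω : ℝ × ℝ, (ω.1 - G (√(v₀⁻¹ - 1) * ω.1 + ω.2, f ω.1)) ^ 2
        ∂(stdGaussian.prod stdGaussian) ≤ (1 + t) * m + (1 + t⁻¹) * ε := by
      calc _ ≤ ∫ ω : ℝ × ℝ, ((1 + t) * (ω.1 - g (√(v₀⁻¹ - 1) * ω.1 + ω.2, f ω.1)) ^ 2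
            + (1 + t⁻¹) * (g (√(v₀⁻¹ - 1) * ω.1 + ω.2, f ω.1)
              - G (√(v₀⁻¹ - 1) * ω.1 + ω.2, f ω.1)) ^ 2) ∂(stdGaussian.prod stdGaussian) := by
            refine integral_mono (memLp_fst2.sub hGT).integrable_sq (i1.add i2) fun ω => ?_
            set a := ω.1 - g (√(v₀⁻¹ - 1) * ω.1 + ω.2, f ω.1)
            set b := g (√(v₀⁻¹ - 1) * ω.1 + ω.2, f ω.1) - G (√(v₀⁻¹ - 1) * ω.1 + ω.2, f ω.1)
              with hb
            have hab : ω.1 - G (√(v₀⁻¹ - 1) * ω.1 + ω.2, f ω.1) = a + b := by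
              simp only [a, b]; ring
            rw [hab]
            have h2 : (1 + t) * a ^ 2 + (1 + t⁻¹) * b ^ 2 - (a + b) ^ 2
                = t * (a - t⁻¹ * b) ^ 2 := by
              field_simp; ring
            have h3 : 0 ≤ t * (a - t⁻¹ * b) ^ 2 := by positivity
            linarith
        _ ≤ (1 + t) * m + (1 + t⁻¹) * ε := by
            rw [integral_add i1 i2, integral_const_mul, integral_const_mul]
            rw [← hm']
            gcongr
    have : (1 + t⁻¹) * ε = (c - (1 + t) * m) / 2 := by
      rw [hε]; field_simp
    linarith
  have hlim : Tendsto (fun x : ℝ × ℝ => ∫ ω : ℝ × ℝ × ℝ,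
      (ω.1 - G (√(x.1⁻¹ - 1) * ω.1 + ω.2.2, f (ω.1 + √x.2 * ω.2.1))) ^ 2 ∂gauss3)
      (𝓝[dom] (v₀, 0)) (𝓝 (∫ ω : ℝ × ℝ, (ω.1 - G (√(v₀⁻¹ - 1) * ω.1 + ω.2, f ω.1)) ^ 2
        ∂(stdGaussian.prod stdGaussian))) := by
    have h3 := integral_map (μ := gauss3) measurePreserving_drop.measurable.aemeasurable
      (f := fun ω : ℝ × ℝ => (ω.1 - G (√(v₀⁻¹ - 1) * ω.1 + ω.2, f ω.1)) ^ 2)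
      (by rw [measurePreserving_drop.map_eq]
          exact (memLp_fst2.sub hGT).integrable_sq.aestronglyMeasurable)
    rw [measurePreserving_drop.map_eq] at h3
    rw [h3]
    have hbd : MemLp (fun ω : ℝ × ℝ × ℝ => |ω.1| + ‖G‖) 2 gauss3 :=
      memLp_fst3.norm.add (memLp_const _)
    refine tendsto_integral_filter_of_dominated_convergence
      (fun ω => (|ω.1| + ‖G‖) ^ 2) ?_ ?_ hbd.integrable_sq ?_
    · refine Eventually.of_forall fun x => Measurable.aestronglyMeasurable ?_
      have h1 : Measurable fun ω : ℝ × ℝ × ℝ =>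
          G (√(x.1⁻¹ - 1) * ω.1 + ω.2.2, f (ω.1 + √x.2 * ω.2.1)) :=
        hGcont.measurable.comp (by fun_prop)
      fun_prop
    · refine Eventually.of_forall fun x => Eventually.of_forall fun ω => ?_
      rw [Real.norm_eq_abs, abs_of_nonneg (sq_nonneg _)]
      refine sq_le_sq.2 ?_
      rw [abs_of_nonneg (by positivity : 0 ≤ |ω.1| + ‖G‖)]
      exact (abs_sub _ _).trans (by gcongr; exact G.norm_coe_le_norm _)
    -- Continuity of `G` suffices because `f` is continuous at almost every value of the signal,
    -- even though it may jump between pieces.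
    · have hae : ∀ᵐ ω ∂gauss3, ContinuousAt f ω.1 :=
        (measurePreserving_fst (μ := stdGaussian)
          (ν := stdGaussian.prod stdGaussian)).quasiMeasurePreserving.ae D.ae_continuousAt
      filter_upwards [hae] with ω hω
      refine Tendsto.mono_left ?_ nhdsWithin_le_nhds
      have c1 : Tendsto (fun x : ℝ × ℝ => √(x.1⁻¹ - 1) * ω.1 + ω.2.2) (𝓝 (v₀, 0))
          (𝓝 (√(v₀⁻¹ - 1) * ω.1 + ω.2.2)) := by
        have : ContinuousAt (fun x : ℝ × ℝ => √(x.1⁻¹ - 1) * ω.1 + ω.2.2) (v₀, 0) := by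
          have := hv₀.ne'
          fun_prop (disch := assumption)
        exact this
      have c2 : Tendsto (fun x : ℝ × ℝ => ω.1 + √x.2 * ω.2.1) (𝓝 (v₀, 0)) (𝓝 ω.1) := by
        have : ContinuousAt (fun x : ℝ × ℝ => ω.1 + √x.2 * ω.2.1) (v₀, 0) := by fun_prop
        simpa [ContinuousAt] using this
      exact (((hGcont.tendsto _).comp (c1.prodMk_nhds (hω.tendsto.comp c2))).const_sub _).pow 2
  filter_upwards [hlim.eventually (gt_mem_nhds hlt), self_mem_nhdsWithin] with x hx ⟨hv, hv1, hs⟩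
  refine (mmseZNoisy_le hf hv hv1 (g := G) hGcont.measurable ?_).trans_lt hx
  refine MemLp.of_bound (hGcont.measurable.comp (by fun_prop)).aestronglyMeasurable ‖G‖
      (Eventually.of_forall fun ω => G.norm_coe_le_norm _)

end Pieces

end Limits

/-! ### Nonzero information dimension forces an injective piece of positive mass. -/

section Dimension

/-- Each term satisfies `-x log x ≤ 1`. This is cruder than the logarithm of the cardinality, but
any bound uniform in the quantization level is enough. -/
lemma entropy_le_card {ν : Measure ℤ} [IsProbabilityMeasure ν] {S : Finset ℤ}
    (hS : ν (S : Set ℤ)ᶜ = 0) : entropy ν ≤ S.card := by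
  unfold entropy
  rw [tsum_eq_sum (s := S)]
  · refine (Finset.sum_le_card_nsmul _ _ 1 fun k _ => ?_).trans (by simp)
    rw [← ENNReal.ofReal_one]
    refine ENNReal.ofReal_le_ofReal ?_
    set x := ν.real {k}
    have hx : 0 ≤ x := measureReal_nonneg
    rcases hx.eq_or_lt with h | h
    · rw [← h]; simp
    · have h1 := mul_le_mul_of_nonneg_left (Real.one_sub_inv_le_log_of_pos h) hx
      rw [mul_sub, mul_inv_cancel₀ h.ne'] at h1
      rw [Real.negMulLog]
      linarith
  · intro k hk
    have : ν {k} = 0 := measure_mono_null (by simpa using hk) hS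
    simp [Measure.real, this]

/-- If the injective pieces were null, `f(Z)` would almost surely take finitely many values. The
quantized entropies would be bounded in `M`, and division by `log M` would give dimension `0`. -/
lemma Pieces.p_pos {f : ℝ → ℝ} (D : Pieces f) {d : ℝ≥0}
    (hd : HasInformationDimension (outputLaw f) d) (hd0 : d ≠ 0) : 0 < D.p := by
  classical
  refine D.p_nonneg.lt_of_ne fun hp => hd0 ?_
  have hp0 : stdGaussian D.injSet = 0 := by
    rw [Pieces.p, Measure.real, eq_comm, ENNReal.toReal_eq_zero_iff] at hp
    exact hp.resolve_right (measure_ne_top _ _)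
  choose c hc using D.J_const
  have hbound : ∀ M : ℕ, quantizedEntropy (outputLaw f) M
      ≤ Fintype.card {k : Fin D.K // ¬ Set.InjOn f (D.I k)} := by
    intro M
    have hm : Measurable fun x : ℝ => ⌊(M : ℝ) * x⌋ := Int.measurable_floor.comp (by fun_prop)
    have hfm := D.measurable
    have i1 : IsProbabilityMeasure (outputLaw f) :=
      Measure.isProbabilityMeasure_map hfm.aemeasurable
    have i2 := Measure.isProbabilityMeasure_map (μ := outputLaw f) hm.aemeasurable
    refine (entropy_le_card (S := Finset.univ.image fun k => ⌊(M : ℝ) * c k⌋) ?_).trans ?_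
    · rw [Measure.map_apply hm (by measurability), outputLaw,
        Measure.map_apply hfm (hm (by measurability))]
      refine measure_mono_null (fun x hx => ?_) hp0
      by_contra hx'
      refine hx ?_
      have : x ∈ ⋃ k, D.I k := by rw [D.cover]; trivial
      obtain ⟨k, hk⟩ := Set.mem_iUnion.1 this
      have hk' : ¬ Set.InjOn f (D.I k) := fun h => hx' ((D.mem_injSet_iff hk).2 h)
      simp only [Finset.coe_image, Finset.coe_univ, Set.image_univ, Set.mem_range]
      exact ⟨⟨k, hk'⟩, by rw [hc ⟨k, hk'⟩ x hk]⟩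
    · exact_mod_cast Finset.card_image_le
  have hlog : Tendsto (fun M : ℕ => ENNReal.ofReal (Real.log M)) atTop (𝓝 ∞) :=
    ENNReal.tendsto_ofReal_atTop.comp (Real.tendsto_log_atTop.comp tendsto_natCast_atTop_atTop)
  have hz : Tendsto (fun M : ℕ => (Fintype.card {k : Fin D.K // ¬ Set.InjOn f (D.I k)} : ℝ≥0∞)
      / ENNReal.ofReal (Real.log M)) atTop (𝓝 0) := by
    have := ENNReal.Tendsto.const_div hlog
      (a := (Fintype.card {k : Fin D.K // ¬ Set.InjOn f (D.I k)} : ℝ≥0∞))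
      (Or.inr (ENNReal.natCast_ne_top _))
    simpa using this
  have hz' := tendsto_of_tendsto_of_tendsto_of_le_of_le tendsto_const_nhds hz
    (fun M => zero_le) fun M => ENNReal.div_le_div_right (hbound M) _
  exact_mod_cast tendsto_nhds_unique hd hz'

end Dimension

/-! ### The spectral maps as real functions of the precision `w = 1 / V`. -/

section Spectral

/-- `E[λ / (1 + λ w)]`. -/
noncomputable def specF (P : Measure ℝ) (w : ℝ) : ℝ := ∫ x, (w + x⁻¹)⁻¹ ∂P

/-- `E[1 / (1 + λ w)]`, the value of `mse` at `V = 1 / w`. -/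
noncomputable def specMu (P : Measure ℝ) (w : ℝ) : ℝ := ∫ x, (1 + x * w)⁻¹ ∂P

/-- The reciprocal of `Φ` at `V = 1 / w`. -/
noncomputable def specPsi (P : Measure ℝ) (δ w : ℝ) : ℝ := δ / specF P w - w

namespace IsSpectralLaw

variable {P : Measure ℝ} {δ : ℝ}

lemma ae_pos (hP : IsSpectralLaw P δ) : ∀ᵐ x ∂P, 0 < x := by
  obtain ⟨a, b, ha, h⟩ := hP.support
  filter_upwards [h] with x hx
  exact ha.trans_le hx.1

lemma integrable_F (hP : IsSpectralLaw P δ) {w : ℝ} (hw : 0 ≤ w) :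
    Integrable (fun x => (w + x⁻¹)⁻¹) P := by
  have := hP.isProb
  obtain ⟨a, b, ha, h⟩ := hP.support
  refine Integrable.of_bound (by fun_prop : Measurable fun x : ℝ => (w + x⁻¹)⁻¹).aestronglyMeasurable
    b ?_
  filter_upwards [h] with x hx
  have hx0 : 0 < x := ha.trans_le hx.1
  rw [Real.norm_eq_abs, abs_of_nonneg (by positivity)]
  refine le_trans ?_ hx.2
  exact inv_le_of_inv_le₀ hx0 (by linarith)

lemma integrable_mu (hP : IsSpectralLaw P δ) {w : ℝ} (hw : 0 ≤ w) :
    Integrable (fun x => (1 + x * w)⁻¹) P := by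
  have := hP.isProb
  refine Integrable.of_bound
    (by fun_prop : Measurable fun x : ℝ => (1 + x * w)⁻¹).aestronglyMeasurable 1 ?_
  filter_upwards [hP.ae_pos] with x hx
  rw [Real.norm_eq_abs, abs_of_nonneg (by positivity)]
  exact inv_le_one_of_one_le₀ (by nlinarith [mul_nonneg hx.le hw])

lemma mul_specF (hP : IsSpectralLaw P δ) {w : ℝ} (hw : 0 ≤ w) :
    w * specF P w = 1 - specMu P w := by
  have := hP.isProb
  unfold specF specMu
  have h1 : ∫ x, (1 - (1 + x * w)⁻¹) ∂P = 1 - ∫ x, (1 + x * w)⁻¹ ∂P := by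
    rw [integral_sub (integrable_const _) (hP.integrable_mu hw)]
    simp
  rw [← integral_const_mul, ← h1]
  refine integral_congr_ae ?_
  filter_upwards [hP.ae_pos] with x hx
  have h2 : 0 < w + x⁻¹ := by positivity
  have h3 : 0 < 1 + x * w := by positivity
  have h4 : w + x⁻¹ = (1 + x * w) / x := by field_simp; ring
  rw [h4]
  field_simp
  ring

lemma exists_le_specF (hP : IsSpectralLaw P δ) :
    ∃ a, 0 < a ∧ ∀ w, 0 ≤ w → (w + a⁻¹)⁻¹ ≤ specF P w := by
  have := hP.isProb
  obtain ⟨a, b, ha, h⟩ := hP.support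
  refine ⟨a, ha, fun w hw => ?_⟩
  calc (w + a⁻¹)⁻¹ = ∫ _, (w + a⁻¹)⁻¹ ∂P := by simp
    _ ≤ _ := by
      refine integral_mono_ae (integrable_const _) (hP.integrable_F hw) ?_
      filter_upwards [h] with x hx
      have hx0 : 0 < x := ha.trans_le hx.1
      have := inv_anti₀ ha hx.1
      exact inv_anti₀ (by positivity) (by linarith)

lemma specF_pos (hP : IsSpectralLaw P δ) {w : ℝ} (hw : 0 ≤ w) : 0 < specF P w := by
  obtain ⟨a, ha, h⟩ := hP.exists_le_specF
  exact lt_of_lt_of_le (by positivity) (h w hw)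

lemma specF_zero (hP : IsSpectralLaw P δ) : specF P 0 = δ := by
  simp [specF, hP.mean]

lemma specMu_nonneg (hP : IsSpectralLaw P δ) {w : ℝ} (hw : 0 ≤ w) : 0 ≤ specMu P w := by
  refine integral_nonneg_of_ae ?_
  filter_upwards [hP.ae_pos] with x hx
  simp only [Pi.zero_apply]
  positivity

lemma specMu_anti (hP : IsSpectralLaw P δ) {w w' : ℝ} (hw : 0 ≤ w) (hww' : w ≤ w') :
    specMu P w' ≤ specMu P w := by
  refine integral_mono_ae (hP.integrable_mu (hw.trans hww')) (hP.integrable_mu hw) ?_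
  filter_upwards [hP.ae_pos] with x hx
  exact inv_anti₀ (by positivity) (by gcongr)

lemma specMu_le_one (hP : IsSpectralLaw P δ) {w : ℝ} (hw : 0 ≤ w) : specMu P w ≤ 1 := by
  have := hP.isProb
  refine (hP.specMu_anti le_rfl hw).trans_eq ?_
  simp [specMu]

lemma specPsi_eq (hP : IsSpectralLaw P δ) {w : ℝ} (hw : 0 ≤ w) :
    specPsi P δ w = (δ - 1 + specMu P w) / specF P w := by
  have h := hP.mul_specF hw
  have h2 := hP.specF_pos hw
  rw [specPsi, eq_div_iff h2.ne', sub_mul, div_mul_cancel₀ _ h2.ne', h]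
  ring

/-- Jensen for the concave map `B ↦ B / (1 + h B)` with `h = w' - w`. Equivalently, `1 / specF`
grows with slope at least `1`. -/
lemma specF_mul_le (hP : IsSpectralLaw P δ) {w w' : ℝ} (hw : 0 ≤ w) (hww' : w ≤ w') :
    specF P w' * (1 + (w' - w) * specF P w) ≤ specF P w := by
  have := hP.isProb
  set b := specF P w with hb
  have hb0 : 0 < b := hP.specF_pos hw
  set h := w' - w with hh
  have hh0 : 0 ≤ h := sub_nonneg.2 hww'
  have hk : 0 < 1 + h * b := by positivity
  have i1 := hP.integrable_F hw
  -- The integrand on the right is the tangent line at the mean `b`; its linear term integrates to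
  -- zero.
  have hle : specF P w' ≤ ∫ x, (b / (1 + h * b) + ((w + x⁻¹)⁻¹ - b) / (1 + h * b) ^ 2) ∂P := by
    refine integral_mono_ae (hP.integrable_F (hw.trans hww'))
      ((integrable_const _).add ((i1.sub (integrable_const _)).div_const _)) ?_
    filter_upwards [hP.ae_pos] with x hx
    have hB : 0 < w + x⁻¹ := by positivity
    set B := (w + x⁻¹)⁻¹ with hBdef
    have hB0 : 0 < B := by positivity
    have hk' : 0 < 1 + h * B := by positivity
    have e1 : (w' + x⁻¹)⁻¹ = B / (1 + h * B) := by
      have : w' + x⁻¹ = B⁻¹ + h := by rw [hBdef, inv_inv]; ring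
      rw [this]
      field_simp
    rw [e1]
    have e2 : b / (1 + h * b) + (B - b) / (1 + h * b) ^ 2 - B / (1 + h * B)
        = h * (B - b) ^ 2 / ((1 + h * b) ^ 2 * (1 + h * B)) := by
      field_simp
      ring
    have e3 : 0 ≤ h * (B - b) ^ 2 / ((1 + h * b) ^ 2 * (1 + h * B)) := by positivity
    linarith
  have heq : ∫ x, (b / (1 + h * b) + ((w + x⁻¹)⁻¹ - b) / (1 + h * b) ^ 2) ∂P
      = b / (1 + h * b) := by
    have i2 : Integrable (fun x => ((w + x⁻¹)⁻¹ - b) / (1 + h * b) ^ 2) P :=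
      (i1.sub (integrable_const _)).div_const _
    rw [integral_add (integrable_const _) i2, integral_div ((1 + h * b) ^ 2), integral_sub i1 (integrable_const _)]
    have : ∫ x, (w + x⁻¹)⁻¹ ∂P = b := rfl
    rw [this]
    simp
  rw [heq, le_div_iff₀ hk] at hle
  exact hle

lemma specPsi_mono (hP : IsSpectralLaw P δ) {w w' : ℝ} (hw : 0 ≤ w) (hww' : w ≤ w') :
    specPsi P δ w ≤ specPsi P δ w' := by
  have h1 := hP.specF_mul_le hw hww'
  have p1 := hP.specF_pos hw
  have p2 := hP.specF_pos (hw.trans hww')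
  have hδ := hP.one_lt
  have h2 : 1 / specF P w + (w' - w) ≤ 1 / specF P w' := by
    rw [le_div_iff₀ p2, add_mul, div_mul_eq_mul_div, one_mul]
    have : specF P w' / specF P w + (w' - w) * specF P w'
        = specF P w' * (1 + (w' - w) * specF P w) / specF P w := by
      field_simp
    rw [this]
    exact (div_le_one p1).2 h1
  have h3 := mul_le_mul_of_nonneg_left h2 (by linarith : 0 ≤ δ)
  have h4 : 0 ≤ (δ - 1) * (w' - w) := mul_nonneg (by linarith) (by linarith)
  rw [mul_add, mul_one_div, mul_one_div] at h3
  unfold specPsi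
  nlinarith

/-- At `w = 0` the mean `E[λ] = δ` gives exactly `1`, and monotonicity does the rest. This keeps
`V_r` in `(0, 1]`. -/
lemma one_le_specPsi (hP : IsSpectralLaw P δ) {w : ℝ} (hw : 0 ≤ w) : 1 ≤ specPsi P δ w := by
  have hδ := hP.one_lt
  refine le_trans ?_ (hP.specPsi_mono le_rfl hw)
  rw [specPsi, hP.specF_zero, div_self (by linarith)]
  simp

lemma le_specPsi (hP : IsSpectralLaw P δ) {w : ℝ} (hw : 0 ≤ w) :
    (δ - 1) * w ≤ specPsi P δ w := by
  have h1 := hP.mul_specF hw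
  have h2 := hP.specF_pos hw
  have h3 := hP.specMu_nonneg hw
  have hδ := hP.one_lt
  have h4 : δ * w ≤ δ / specF P w := by
    rw [le_div_iff₀ h2]
    nlinarith
  unfold specPsi
  linarith

/-- The spectral gap `a > 0` bounds the offset from slope `δ - 1`, so a large `specPsi` forces a
large `w`. -/
lemma exists_specPsi_le (hP : IsSpectralLaw P δ) :
    ∃ B, ∀ w, 0 ≤ w → specPsi P δ w ≤ (δ - 1) * w + B := by
  obtain ⟨a, ha, h⟩ := hP.exists_le_specF
  have hδ := hP.one_lt
  refine ⟨δ * a⁻¹, fun w hw => ?_⟩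
  have h1 : (specF P w)⁻¹ ≤ w + a⁻¹ := inv_le_of_inv_le₀ (by positivity) (h w hw)
  have h2 := mul_le_mul_of_nonneg_left h1 (by linarith : 0 ≤ δ)
  rw [specPsi, div_eq_mul_inv]
  linarith

lemma continuousOn_specF (hP : IsSpectralLaw P δ) : ContinuousOn (specF P) (Set.Ici 0) := by
  have := hP.isProb
  obtain ⟨a, b, ha, h⟩ := hP.support
  refine continuousOn_of_dominated (bound := fun _ => b) ?_ ?_ (integrable_const _) ?_
  · intro w _
    exact (by fun_prop : Measurable fun x : ℝ => (w + x⁻¹)⁻¹).aestronglyMeasurable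
  · intro w hw
    rw [Set.mem_Ici] at hw
    filter_upwards [h] with x hx
    have hx0 : 0 < x := ha.trans_le hx.1
    rw [Real.norm_eq_abs, abs_of_nonneg (by positivity)]
    exact le_trans (inv_le_of_inv_le₀ hx0 (by linarith)) hx.2
  · filter_upwards [hP.ae_pos] with x hx
    refine ContinuousOn.inv₀ (by fun_prop) fun w hw => ?_
    rw [Set.mem_Ici] at hw
    positivity

lemma continuousOn_specPsi (hP : IsSpectralLaw P δ) :
    ContinuousOn (specPsi P δ) (Set.Ici 0) :=
  (continuousOn_const.div hP.continuousOn_specF fun _ hw => (hP.specF_pos hw).ne').sub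
    continuousOn_id

lemma continuousOn_specMu (hP : IsSpectralLaw P δ) : ContinuousOn (specMu P) (Set.Ici 0) := by
  have h : ContinuousOn (fun w => 1 - w * specF P w) (Set.Ici 0) :=
    continuousOn_const.sub (continuousOn_id.mul hP.continuousOn_specF)
  refine h.congr fun w hw => ?_
  simp only [hP.mul_specF hw, sub_sub_cancel]

lemma tendsto_mul_specMu (hP : IsSpectralLaw P δ) :
    Tendsto (fun w => w * specMu P w) atTop (𝓝 (∫ x, x⁻¹ ∂P)) := by
  have := hP.isProb
  obtain ⟨a, b, ha, h⟩ := hP.support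
  simp_rw [specMu, ← integral_const_mul]
  refine tendsto_integral_filter_of_dominated_convergence (fun _ => a⁻¹) ?_ ?_
    (integrable_const _) ?_
  · exact Eventually.of_forall fun w =>
      (by fun_prop : Measurable fun x : ℝ => w * (1 + x * w)⁻¹).aestronglyMeasurable
  · filter_upwards [eventually_ge_atTop 0] with w hw
    filter_upwards [h] with x hx
    have hx0 : 0 < x := ha.trans_le hx.1
    rw [Real.norm_eq_abs, abs_of_nonneg (by positivity)]
    rw [← div_eq_mul_inv, div_le_iff₀ (by positivity)]
    have : a⁻¹ * a = 1 := inv_mul_cancel₀ ha.ne'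
    have h1 : a⁻¹ * (a * w) ≤ a⁻¹ * (1 + x * w) := by
      gcongr
      nlinarith [hx.1]
    nlinarith
  · filter_upwards [hP.ae_pos] with x hx
    have h1 : Tendsto (fun w : ℝ => (w⁻¹ + x)⁻¹) atTop (𝓝 (0 + x)⁻¹) :=
      (tendsto_inv_atTop_zero.add_const x).inv₀ (by simpa using hx.ne')
    rw [zero_add] at h1
    refine h1.congr' ?_
    filter_upwards [eventually_gt_atTop 0] with w hw
    have : w⁻¹ + x = (1 + x * w) / w := by field_simp
    rw [this, inv_div, div_eq_mul_inv]

lemma tendsto_specMu (hP : IsSpectralLaw P δ) : Tendsto (specMu P) atTop (𝓝 0) := by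
  have h := hP.tendsto_mul_specMu.mul tendsto_inv_atTop_zero
  rw [mul_zero] at h
  refine h.congr' ?_
  filter_upwards [eventually_gt_atTop 0] with w hw
  field_simp

lemma integral_inv_pos (hP : IsSpectralLaw P δ) : 0 < ∫ x, x⁻¹ ∂P := by
  have := hP.isProb
  obtain ⟨a, b, ha, h⟩ := hP.support
  have hi : Integrable (fun x : ℝ => x⁻¹) P := by
    refine Integrable.of_bound measurable_inv.aestronglyMeasurable a⁻¹ ?_
    filter_upwards [h] with x hx
    have hx0 : 0 < x := ha.trans_le hx.1
    rw [Real.norm_eq_abs, abs_of_nonneg (by positivity)]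
    exact inv_anti₀ ha hx.1
  rw [integral_pos_iff_support_of_nonneg_ae ?_ hi]
  · have : P (Function.support fun x : ℝ => x⁻¹)ᶜ = 0 := by
      refine measure_eq_zero_iff_ae_notMem.2 ?_
      filter_upwards [hP.ae_pos] with x hx
      simp [hx.ne']
    have h1 := (prob_compl_eq_zero_iff₀ (μ := P) (by
      exact (measurableSet_support measurable_inv).nullMeasurableSet)).1 this
    rw [h1]
    exact one_pos
  · filter_upwards [hP.ae_pos] with x hx
    simp only [Pi.zero_apply]
    positivity

lemma extrinsic_eq {m v : ℝ} (hm : 0 < m) (hv : 0 < v) :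
    extrinsic m v = (ENNReal.ofReal (m⁻¹ - v⁻¹))⁻¹ := by
  rw [extrinsic, ← ENNReal.ofReal_inv_of_pos hm, ← ENNReal.ofReal_inv_of_pos hv,
    ← ENNReal.ofReal_sub _ (by positivity)]

lemma mse_inv (hP : IsSpectralLaw P δ) {w : ℝ} (hw : 0 ≤ w) :
    mse P (ENNReal.ofReal w)⁻¹ = specMu P w := by
  refine integral_congr_ae ?_
  filter_upwards [hP.ae_pos] with x hx
  rw [div_eq_mul_inv, inv_inv, ← ENNReal.ofReal_mul hx.le, ← ENNReal.ofReal_one,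
    ← ENNReal.ofReal_add zero_le_one (by positivity),
    ← ENNReal.ofReal_inv_of_pos (by positivity), ENNReal.toReal_ofReal (by positivity)]

lemma mse_zero (hP : IsSpectralLaw P δ) : mse P 0 = 0 := by
  rw [mse, ← integral_zero ℝ ℝ (μ := P)]
  refine integral_congr_ae ?_
  filter_upwards [hP.ae_pos] with x hx
  rw [ENNReal.div_zero (by simpa using hx)]
  simp

lemma eq_zero_of_mse_eq_zero (hP : IsSpectralLaw P δ) {V : ℝ≥0∞} (h : mse P V = 0) : V = 0 := by
  have := hP.isProb
  by_contra hV
  have hpos : ∀ᵐ x ∂P, 0 < ((1 + ENNReal.ofReal x / V)⁻¹).toReal := by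
    filter_upwards with x
    refine ENNReal.toReal_pos ?_ ?_
    · rw [ENNReal.inv_ne_zero]
      exact ENNReal.add_ne_top.2 ⟨ENNReal.one_ne_top, ENNReal.div_ne_top ENNReal.ofReal_ne_top hV⟩
    · rw [ENNReal.inv_ne_top]
      exact (add_pos_of_pos_of_nonneg one_pos zero_le).ne'
  have hint : Integrable (fun x => ((1 + ENNReal.ofReal x / V)⁻¹).toReal) P := by
    refine Integrable.of_bound (by
      exact (by fun_prop : Measurable fun x : ℝ =>
        ((1 + ENNReal.ofReal x / V)⁻¹).toReal).aestronglyMeasurable) 1 ?_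
    filter_upwards with x
    rw [Real.norm_eq_abs, abs_of_nonneg ENNReal.toReal_nonneg]
    refine ENNReal.toReal_le_of_le_ofReal zero_le_one ?_
    rw [ENNReal.ofReal_one]
    exact ENNReal.inv_le_one.2 le_self_add
  have h0 := (integral_eq_zero_iff_of_nonneg_ae
    (Eventually.of_forall fun x => ENNReal.toReal_nonneg) hint).1 h
  have : ∀ᵐ _ ∂P, False := by
    filter_upwards [hpos, h0] with x h1 h2
    rw [h2] at h1
    exact lt_irrefl _ h1
  rw [eventually_false_iff_eq_bot, ae_eq_bot] at this
  exact IsProbabilityMeasure.ne_zero P this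

/-- Moves the recursion from `[0, ∞]` to the reals; `w = 0` covers `V = ∞`. -/
lemma PhiMap_inv (hP : IsSpectralLaw P δ) {w : ℝ} (hw : 0 ≤ w) :
    PhiMap P δ (ENNReal.ofReal w)⁻¹ = (specPsi P δ w)⁻¹ := by
  have hδ : 0 < δ := by linarith [hP.one_lt]
  have hF := hP.specF_pos hw
  have h1 : ∫⁻ x, (((ENNReal.ofReal w)⁻¹)⁻¹ + (ENNReal.ofReal x)⁻¹)⁻¹ ∂P
      = ENNReal.ofReal (specF P w) := by
    rw [specF, ofReal_integral_eq_lintegral_ofReal (hP.integrable_F hw)]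
    · refine lintegral_congr_ae ?_
      filter_upwards [hP.ae_pos] with x hx
      rw [inv_inv, ← ENNReal.ofReal_inv_of_pos hx, ← ENNReal.ofReal_add hw (by positivity),
        ← ENNReal.ofReal_inv_of_pos (by positivity)]
    · filter_upwards [hP.ae_pos] with x hx
      simp only [Pi.zero_apply]
      positivity
  rw [PhiMap, h1, inv_inv, ← ENNReal.ofReal_inv_of_pos hδ, ← ENNReal.ofReal_mul (by positivity),
    ← ENNReal.ofReal_inv_of_pos (by positivity), ← ENNReal.ofReal_sub _ hw]
  have h2 : (δ⁻¹ * specF P w)⁻¹ - w = specPsi P δ w := by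
    rw [specPsi, mul_inv, inv_inv, div_eq_mul_inv]
  have h3 := hP.one_le_specPsi hw
  rw [h2, ← ENNReal.ofReal_inv_of_pos (by linarith), ENNReal.toReal_ofReal (by positivity)]

end IsSpectralLaw

end Spectral

/-! ### Monotone convergence of the noisy state evolution. -/

section Dynamics

/-- The extrinsic precision `1 / φ(v, s)`. -/
noncomputable def prec (f : ℝ → ℝ) (s v : ℝ) : ℝ := (mmseZNoisy f s v)⁻¹ - v⁻¹

variable {f : ℝ → ℝ} {P : Measure ℝ} {δ s v : ℝ}

lemma mmseZNoisy_pos (hf : Measurable f) (hs : 0 < s) (hv : 0 < v) (hv1 : v ≤ 1) :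
    0 < mmseZNoisy f s v :=
  lt_of_lt_of_le (by positivity) (mul_div_add_le_mmseZNoisy hf hs.le hv hv1)

lemma prec_nonneg (hf : Measurable f) (hs : 0 < s) (hv : 0 < v) (hv1 : v ≤ 1) :
    0 ≤ prec f s v :=
  sub_nonneg.2 (inv_anti₀ (mmseZNoisy_pos hf hs hv hv1) (mmseZNoisy_le_self hf hs.le hv hv1))

lemma prec_le (hf : Measurable f) (hs : 0 < s) (hv : 0 < v) (hv1 : v ≤ 1) :
    prec f s v ≤ s⁻¹ := by
  have h := inv_anti₀ (by positivity) (mul_div_add_le_mmseZNoisy hf hs.le hv hv1)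
  have h2 : (v * (s / (v + s)))⁻¹ = s⁻¹ + v⁻¹ := by field_simp
  rw [h2] at h
  unfold prec
  linarith

/-- Extra Gaussian side information of precision `h` reduces the MMSE at least as much as it would
for the best linear correction, so `1 / mmse - 1 / v` cannot drop when `v` does. -/
lemma prec_anti (hf : Measurable f) (hs : 0 < s) {v' : ℝ} (hv' : 0 < v') (hvv' : v' ≤ v)
    (hv1 : v ≤ 1) : prec f s v ≤ prec f s v' := by
  rcases hvv'.eq_or_lt with rfl | hlt
  · exact le_rfl
  have h := mmseZNoisy_mul_le (s := s) hf hv' hlt hv1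
  have p1 := mmseZNoisy_pos hf hs (hv'.trans hlt) hv1
  have p2 := mmseZNoisy_pos hf hs hv' (hlt.le.trans hv1)
  unfold prec
  set m := mmseZNoisy f s v
  set m' := mmseZNoisy f s v'
  have h2 : m⁻¹ + (v'⁻¹ - v⁻¹) ≤ m'⁻¹ := by
    have : m⁻¹ + (v'⁻¹ - v⁻¹) = (1 + (v'⁻¹ - v⁻¹) * m) / m := by
      rw [add_div, mul_div_cancel_right₀ _ p1.ne', one_div]
    rw [this, div_le_iff₀ p1, inv_mul_eq_div, le_div_iff₀ p2]
    linarith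
  linarith

lemma phiNoisy_eq (hf : Measurable f) (hs : 0 < s) (hv : 0 < v) (hv1 : v ≤ 1) :
    phiNoisy f s v = (ENNReal.ofReal (prec f s v))⁻¹ :=
  IsSpectralLaw.extrinsic_eq (mmseZNoisy_pos hf hs hv hv1) hv

lemma ratio_eq (hf : Measurable f) (hs : 0 < s) (hv : 0 < v) (hv1 : v ≤ 1) :
    mmseZNoisy f s v / v = (1 + v * prec f s v)⁻¹ := by
  have h := mmseZNoisy_pos hf hs hv hv1
  unfold prec
  rw [mul_sub, mul_inv_cancel₀ hv.ne', add_sub_cancel, mul_inv, inv_inv, inv_mul_eq_div]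

namespace IsSpectralLaw

lemma VrNoisy_mem (hP : IsSpectralLaw P δ) (hf : Measurable f) (hs : 0 < s) (t : ℕ) :
    0 < VrNoisy f P δ s t ∧ VrNoisy f P δ s t ≤ 1 := by
  induction t with
  | zero => simp [VrNoisy]
  | succ t ih =>
    have hw := prec_nonneg hf hs ih.1 ih.2
    have h1 := hP.one_le_specPsi hw
    rw [VrNoisy, phiNoisy_eq hf hs ih.1 ih.2, hP.PhiMap_inv hw]
    exact ⟨by positivity, inv_le_one_of_one_le₀ h1⟩

lemma VrNoisy_succ (hP : IsSpectralLaw P δ) (hf : Measurable f) (hs : 0 < s) (t : ℕ) :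
    VrNoisy f P δ s (t + 1) = (specPsi P δ (prec f s (VrNoisy f P δ s t)))⁻¹ := by
  have ih := hP.VrNoisy_mem hf hs t
  rw [VrNoisy, phiNoisy_eq hf hs ih.1 ih.2, hP.PhiMap_inv (prec_nonneg hf hs ih.1 ih.2)]

lemma VrNoisy_antitone (hP : IsSpectralLaw P δ) (hf : Measurable f) (hs : 0 < s) :
    Antitone (VrNoisy f P δ s) := by
  refine antitone_nat_of_succ_le fun t => ?_
  induction t with
  | zero => exact (hP.VrNoisy_mem hf hs 1).2
  | succ t ih =>
    have h0 := hP.VrNoisy_mem hf hs t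
    have h1 := hP.VrNoisy_mem hf hs (t + 1)
    have hw := prec_nonneg hf hs h0.1 h0.2
    have h2 := hP.specPsi_mono hw (prec_anti hf hs h1.1 ih h0.2)
    have h3 := hP.one_le_specPsi hw
    rw [hP.VrNoisy_succ hf hs (t + 1), hP.VrNoisy_succ hf hs t]
    rw [hP.VrNoisy_succ hf hs t] at h2
    exact inv_anti₀ (by linarith) h2

/-- The noisy state evolution converges. -/
lemma exists_limit (hP : IsSpectralLaw P δ) (hf : Measurable f) (hs : 0 < s) :
    ∃ W, 0 ≤ W ∧ Tendsto (fun t => prec f s (VrNoisy f P δ s t)) atTop (𝓝 W) ∧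
      Tendsto (VrNoisy f P δ s) atTop (𝓝 (specPsi P δ W)⁻¹) := by
  have hmem := hP.VrNoisy_mem hf hs
  have hmono : Monotone fun t => prec f s (VrNoisy f P δ s t) := fun i j hij =>
    prec_anti hf hs (hmem j).1 (hP.VrNoisy_antitone hf hs hij) (hmem i).2
  have hbdd : BddAbove (Set.range fun t => prec f s (VrNoisy f P δ s t)) := by
    refine ⟨s⁻¹, ?_⟩
    rintro _ ⟨t, rfl⟩
    exact prec_le hf hs (hmem t).1 (hmem t).2
  have hlim := tendsto_atTop_ciSup hmono hbdd
  set W := ⨆ t, prec f s (VrNoisy f P δ s t)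
  have hnn : ∀ t, 0 ≤ prec f s (VrNoisy f P δ s t) := fun t =>
    prec_nonneg hf hs (hmem t).1 (hmem t).2
  have hW : 0 ≤ W := ge_of_tendsto' hlim hnn
  refine ⟨W, hW, hlim, ?_⟩
  -- The limit of `V_r` comes from that of the precisions through continuity of `specPsi`;
  -- continuity of `prec` in `v` is not needed.
  rw [← tendsto_add_atTop_iff_nat 1]
  simp_rw [hP.VrNoisy_succ hf hs]
  refine Tendsto.inv₀ ?_ (by linarith [hP.one_le_specPsi hW])
  exact (hP.continuousOn_specPsi W hW).tendsto.comp
    (tendsto_nhdsWithin_iff.2 ⟨hlim, Eventually.of_forall hnn⟩)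

lemma tendsto_mse (hP : IsSpectralLaw P δ) (hf : Measurable f) (hs : 0 < s) {W : ℝ} (hW : 0 ≤ W)
    (hlim : Tendsto (fun t => prec f s (VrNoisy f P δ s t)) atTop (𝓝 W)) :
    Tendsto (fun t => mse P (VlNoisy f P δ s t)) atTop (𝓝 (specMu P W)) := by
  have hmem := hP.VrNoisy_mem hf hs
  have hnn : ∀ t, 0 ≤ prec f s (VrNoisy f P δ s t) := fun t =>
    prec_nonneg hf hs (hmem t).1 (hmem t).2
  have heq : ∀ t, mse P (VlNoisy f P δ s t) = specMu P (prec f s (VrNoisy f P δ s t)) := by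
    intro t
    rw [VlNoisy, phiNoisy_eq hf hs (hmem t).1 (hmem t).2, hP.mse_inv (hnn t)]
  simp_rw [heq]
  exact (hP.continuousOn_specMu W hW).tendsto.comp
    (tendsto_nhdsWithin_iff.2 ⟨hlim, Eventually.of_forall hnn⟩)

lemma tendsto_ratio_limit (hP : IsSpectralLaw P δ) (hf : Measurable f) (hs : 0 < s) {W : ℝ}
    (hlim : Tendsto (fun t => prec f s (VrNoisy f P δ s t)) atTop (𝓝 W))
    (hv : Tendsto (VrNoisy f P δ s) atTop (𝓝 (specPsi P δ W)⁻¹)) (hW : 0 ≤ W) :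
    Tendsto (fun t => mmseZNoisy f s (VrNoisy f P δ s t) / VrNoisy f P δ s t) atTop
      (𝓝 (1 + (specPsi P δ W)⁻¹ * W)⁻¹) := by
  have hmem := hP.VrNoisy_mem hf hs
  have h1 := hP.one_le_specPsi hW
  have : ∀ t, mmseZNoisy f s (VrNoisy f P δ s t) / VrNoisy f P δ s t
      = (1 + VrNoisy f P δ s t * prec f s (VrNoisy f P δ s t))⁻¹ := fun t =>
    ratio_eq hf hs (hmem t).1 (hmem t).2
  simp_rw [this]
  exact ((hv.mul hlim).const_add 1).inv₀ (by positivity)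

/-- With `ψ = specPsi P δ W` and `F = specF P W`, the left side is `ψ / (ψ + W)`, while `ψ F = δ - 1
+ specMu P W` and `(ψ + W) F = δ`. -/
lemma ratio_limit_eq (hP : IsSpectralLaw P δ) {W : ℝ} (hW : 0 ≤ W) :
    (1 + (specPsi P δ W)⁻¹ * W)⁻¹ = (δ - 1 + specMu P W) / δ := by
  have h1 := hP.one_le_specPsi hW
  have hF := hP.specF_pos hW
  have hδ : 0 < δ := by linarith [hP.one_lt]
  have hpos : 0 < specPsi P δ W := by linarith
  have h2 : specPsi P δ W * specF P W = δ - 1 + specMu P W := by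
    rw [hP.specPsi_eq hW, div_mul_cancel₀ _ hF.ne']
  have h3 : (specPsi P δ W + W) * specF P W = δ := by
    rw [add_mul, h2, hP.mul_specF hW]; ring
  rw [← h2]
  have h4 : δ = (specPsi P δ W + W) * specF P W := h3.symm
  rw [eq_div_iff hδ.ne']
  have hpos' : 0 < specPsi P δ W + W := by linarith
  set ψ := specPsi P δ W
  rw [h4]
  field_simp

end IsSpectralLaw

end Dynamics

/-! ### From the perfect recovery threshold to the linear error law. -/

section Threshold

variable {f : ℝ → ℝ} {P : Measure ℝ} {δ : ℝ}

lemma extrinsic_zero {v : ℝ} (h : 0 < v) : extrinsic 0 v = 0 := by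
  simp [extrinsic, h]

lemma eq_zero_of_extrinsic_eq_zero {m v : ℝ} (hm : 0 ≤ m) (h : extrinsic m v = 0) : m = 0 := by
  rw [extrinsic, ENNReal.inv_eq_zero, ENNReal.sub_eq_top_iff] at h
  have h1 := h.1
  rw [ENNReal.inv_eq_top, ENNReal.ofReal_eq_zero] at h1
  linarith

lemma mmseZ_eq_zero_of_le (hf : Measurable f) {v v' : ℝ} (hv' : 0 < v') (hvv' : v' ≤ v)
    (hv1 : v ≤ 1) (h : mmseZ f v = 0) : mmseZ f v' = 0 := by
  rcases hvv'.eq_or_lt with rfl | hlt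
  · exact h
  have h1 := mmseZNoisy_mul_le (s := 0) hf hv' hlt hv1
  rw [mmseZNoisy_zero hf hv' (hvv'.trans hv1), mmseZNoisy_zero hf (hv'.trans hlt) hv1, h] at h1
  refine le_antisymm (by simpa using h1) mmseGiven_nonneg

lemma Pfun_pos_of_mmseZ_eq_zero (hP : IsSpectralLaw P δ) {δ' v : ℝ} (hδ' : 1 < δ') (hv : 0 < v)
    (h : mmseZ f v = 0) : 0 < Pfun f P δ' v := by
  rw [Pfun, phi, h, extrinsic_zero hv, hP.mse_zero]
  simp only [zero_div]
  linarith

/-- Perfect recovery at `δ'` forces positivity of `P` on `(0, 1]`. -/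
lemma Pfun_pos_of_mseStar_eq_zero (hP : IsSpectralLaw P δ) (hf : Measurable f) {δ' : ℝ}
    (hδ' : 1 < δ') (h : mseStar f P δ' = 0) {v : ℝ} (hv : 0 < v) (hv1 : v ≤ 1) :
    0 < Pfun f P δ' v := by
  have h0 := hP.eq_zero_of_mse_eq_zero h
  have habove : ∀ u, (positiveSet f P δ').Nonempty → sInf (positiveSet f P δ') < u → u ≤ 1 →
      0 < Pfun f P δ' u := by
    intro u hne hlt hu1
    obtain ⟨w, hw, hwu⟩ := exists_lt_of_csInf_lt hne hlt
    exact hw.2 u ⟨hwu.le, hu1⟩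
  -- Zero error at a positive `VrStar` makes the noiseless MMSE vanish there, hence at all smaller
  -- `v`, where `Pfun` is `δ' - 1`. When `VrStar = 0` there is no `v` left to treat, so the value of
  -- `phiExt` at `0` plays no role.
  have hbelow : VrStar f P δ' ≠ 0 → 0 ≤ VrStar f P δ' → VrStar f P δ' ≤ 1 → v ≤ VrStar f P δ' →
      0 < Pfun f P δ' v := by
    intro hne hnn hle hvle
    rw [phiExt, if_neg hne] at h0
    have h1 := eq_zero_of_extrinsic_eq_zero mmseGiven_nonneg h0
    exact Pfun_pos_of_mmseZ_eq_zero hP hδ' hv (mmseZ_eq_zero_of_le hf hv hvle hle h1)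
  by_cases hne : (positiveSet f P δ').Nonempty
  · have hV : VrStar f P δ' = sInf (positiveSet f P δ') := if_pos hne
    rcases lt_or_ge (sInf (positiveSet f P δ')) v with hlt | hge
    · exact habove v hne hlt hv1
    · have hbdd : BddBelow (positiveSet f P δ') := ⟨0, fun x hx => hx.1.1.le⟩
      rw [← hV] at hge
      refine hbelow (by linarith) (by linarith) ?_ hge
      obtain ⟨w, hw⟩ := hne
      rw [hV]
      exact (csInf_le hbdd hw).trans hw.1.2
  · have hV : VrStar f P δ' = 1 := if_neg hne
    exact hbelow (by rw [hV]; exact one_ne_zero) (by rw [hV]; exact zero_le_one) hV.le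
      (by rwa [hV])

lemma exists_of_perfectThreshold_lt (hP : IsSpectralLaw P δ) (hf : Measurable f)
    (h : perfectThreshold f P < (δ : EReal)) :
    ∃ δ', 1 < δ' ∧ δ' < δ ∧ ∀ v, 0 < v → v ≤ 1 → 0 < Pfun f P δ' v := by
  obtain ⟨_, ⟨δ', ⟨h1, h2⟩, rfl⟩, h3⟩ := sInf_lt_iff.1 h
  exact ⟨δ', h1, EReal.coe_lt_coe_iff.1 h3, fun v hv hv1 =>
    Pfun_pos_of_mseStar_eq_zero hP hf h1 h2 hv hv1⟩

lemma mse_phi (hP : IsSpectralLaw P δ) {v : ℝ} (hv : 0 < v) (hm : 0 < mmseZ f v)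
    (hmv : mmseZ f v ≤ v) : mse P (phi f v) = specMu P ((mmseZ f v)⁻¹ - v⁻¹) := by
  rw [phi, IsSpectralLaw.extrinsic_eq hm hv, hP.mse_inv (sub_nonneg.2 (inv_anti₀ hm hmv))]

lemma mmseZ_le_self (hf : Measurable f) {v : ℝ} (hv : 0 < v) (hv1 : v ≤ 1) : mmseZ f v ≤ v := by
  rw [← mmseZNoisy_zero hf hv hv1]
  exact mmseZNoisy_le_self hf le_rfl hv hv1

/-- Positivity of `P` on `(0, 1]` forces `1 ≤ δ' p`. -/
lemma one_le_mul_p (hP : IsSpectralLaw P δ) (D : Pieces f) (hp : 0 < D.p) {δ' : ℝ} (hδ' : 1 < δ')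
    (hpos : ∀ v, 0 < v → v ≤ 1 → 0 < Pfun f P δ' v) : 1 ≤ δ' * D.p := by
  have hf := D.measurable
  by_contra! hlt
  have hmap : Tendsto (fun v : ℝ => (v, (0 : ℝ))) (𝓝[>] 0) (𝓝[dom] (0, 0)) := by
    refine tendsto_nhdsWithin_iff.2 ⟨?_, ?_⟩
    · exact ((Continuous.prodMk continuous_id continuous_const).tendsto' (0 : ℝ) _ rfl).mono_left
        nhdsWithin_le_nhds
    · filter_upwards [Ioc_mem_nhdsGT (zero_lt_one' ℝ)] with v hv
      exact ⟨hv.1, hv.2, le_rfl⟩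
  have hr := D.tendsto_ratio.comp hmap
  -- If `δ' p < 1`, the bracket in `Pfun` tends to `1 - δ' p > 0` as `v → 0`, while the precision is
  -- at least `(p / 2) / v` and drives the `mse` term to `0`. Half the gap separates the two; `p /
  -- 2` in the minimum below serves the precision and `c / δ'` the bracket.
  set c := (1 - δ' * D.p) / 2 with hc
  have hc0 : 0 < c := by rw [hc]; linarith
  have hκ : 0 < min (D.p / 2) (c / δ') := by positivity
  have e1 := hr.eventually (Metric.ball_mem_nhds 0 hκ)
  have hw : Tendsto (fun v : ℝ => D.p / 2 * v⁻¹) (𝓝[>] 0) atTop :=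
    tendsto_inv_nhdsGT_zero.const_mul_atTop (by positivity)
  have e2 := (hP.tendsto_specMu.comp hw).eventually (gt_mem_nhds hc0)
  obtain ⟨v, e1, e2, hv, hv1⟩ := (e1.and (e2.and
    (Ioc_mem_nhdsGT (zero_lt_one' ℝ)))).exists
  simp only [Function.comp_apply, add_zero, div_self hv.ne', mul_one, Real.dist_eq, sub_zero,
    mmseZNoisy_zero hf hv hv1] at e1 e2
  have hP0 := hpos v hv hv1
  have hmv := mmseZ_le_self hf hv hv1
  have hm0 : 0 ≤ mmseZ f v := mmseGiven_nonneg
  set q := mmseZ f v / v with hq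
  obtain ⟨e3, e4⟩ := abs_lt.1 e1
  have k1 := min_le_left (D.p / 2) (c / δ')
  have k2 := min_le_right (D.p / 2) (c / δ')
  have k3 : δ' * (c / δ') = c := mul_div_cancel₀ _ (by linarith)
  have k4 : 1 - D.p - c / δ' < q := by linarith
  have k5 : c < 1 - δ' * (1 - q) := by
    have := mul_lt_mul_of_pos_left k4 (by linarith : 0 < δ')
    rw [mul_sub, k3] at this
    linarith
  have hq0 : 0 < q := by
    by_contra! h
    nlinarith
  have hm : 0 < mmseZ f v := by
    rw [hq] at hq0
    exact (div_pos_iff_of_pos_right hv).1 hq0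
  rw [Pfun, mse_phi hP hv hm hmv] at hP0
  have hle : D.p / 2 * v⁻¹ ≤ (mmseZ f v)⁻¹ - v⁻¹ := by
    have hmq : mmseZ f v = q * v := by rw [hq, div_mul_cancel₀ _ hv.ne']
    have hq1 : q ≤ 1 - D.p / 2 := by linarith
    have : 1 + D.p / 2 ≤ q⁻¹ := by
      rw [le_inv_comm₀ (by positivity) hq0]
      refine hq1.trans ?_
      rw [← one_div, le_div_iff₀ (by positivity)]
      nlinarith
    rw [hmq, mul_inv]
    have h2 := mul_le_mul_of_nonneg_right this (inv_nonneg.2 hv.le)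
    linarith
  have := hP.specMu_anti (by positivity) hle
  linarith

/-- Positivity of `P` in terms of the precision: the next iterate strictly decreases. -/
lemma exists_precision_gap (hP : IsSpectralLaw P δ) (hf : Measurable f) {δ' v : ℝ}
    (hδ' : δ' < δ) (hv : 0 < v) (hv1 : v ≤ 1) (hpos : 0 < Pfun f P δ' v) :
    ∃ w, 0 ≤ w ∧ v⁻¹ < specPsi P δ w ∧ mmseZ f v < (w + v⁻¹)⁻¹ := by
  have hδ := hP.one_lt
  have hmv := mmseZ_le_self hf hv hv1
  have hm0 : 0 ≤ mmseZ f v := mmseGiven_nonneg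
  rcases hm0.eq_or_lt with h0 | hm
  -- With zero MMSE any finite `w` is allowed. This one makes the lower bound `(δ - 1) w` equal to
  -- `v⁻¹ + 1`.
  · have hw : 0 ≤ (v⁻¹ + 1) / (δ - 1) := by
      have : 0 < δ - 1 := by linarith
      positivity
    refine ⟨(v⁻¹ + 1) / (δ - 1), hw, ?_, ?_⟩
    · have := hP.le_specPsi hw
      rw [mul_div_cancel₀ _ (by linarith : δ - 1 ≠ 0)] at this
      linarith
    · rw [← h0]
      positivity
  · rw [Pfun, mse_phi hP hv hm hmv] at hpos
    set m := mmseZ f v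
    set w₀ := m⁻¹ - v⁻¹ with hw₀
    have hw₀n : 0 ≤ w₀ := sub_nonneg.2 (inv_anti₀ hm hmv)
    have hF := hP.specF_pos hw₀n
    have hwF := hP.mul_specF hw₀n
    have hq1 : m / v ≤ 1 := (div_le_one hv).2 hmv
    have h1 : 1 - m / v = m * w₀ := by
      rw [hw₀, mul_sub, mul_inv_cancel₀ hm.ne', div_eq_mul_inv]
    have h2 : w₀ * specF P w₀ < w₀ * (δ * m) := by
      have h3 : δ' * (1 - m / v) ≤ δ * (1 - m / v) := by
        have : 0 ≤ 1 - m / v := by linarith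
        gcongr
      rw [h1] at h3 hpos
      rw [hwF]
      linarith
    have hw₀p : 0 < w₀ := by
      rcases hw₀n.eq_or_lt with h | h
      · rw [← h] at h2; simp at h2
      · exact h
    have h3 : specF P w₀ < δ * m := lt_of_mul_lt_mul_left h2 hw₀n
    have h4 : v⁻¹ < specPsi P δ w₀ := by
      have : m⁻¹ < δ / specF P w₀ := by
        rw [lt_div_iff₀ hF, inv_mul_lt_iff₀ hm]
        linarith
      rw [specPsi]
      linarith
    have hcont : ContinuousAt (specPsi P δ) w₀ :=
      hP.continuousOn_specPsi.continuousAt (Ici_mem_nhds hw₀p)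
    -- The exact precision `w₀` already gives `v⁻¹ < specPsi P δ w₀`. Moving slightly below `w₀`
    -- makes the MMSE inequality strict too, and so stable under perturbation of `v` and `s`.
    have e1 := (hcont.mono_left (nhdsWithin_le_nhds (s := Set.Iio w₀))).eventually
      (lt_mem_nhds h4)
    obtain ⟨w, h5, h6⟩ := (e1.and (Ioo_mem_nhdsLT hw₀p)).exists
    refine ⟨w, h6.1.le, h5, ?_⟩
    have hvp : 0 < v⁻¹ := inv_pos.2 hv
    rw [lt_inv_comm₀ hm (by linarith [h6.1])]
    linarith [h6.2]

/-- The fixed point of the noisy state evolution tends to zero with the noise level. -/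
lemma eventually_fixedPoint_lt (hP : IsSpectralLaw P δ) (D : Pieces f) {δ' : ℝ} (hδ' : δ' < δ)
    (hpos : ∀ v, 0 < v → v ≤ 1 → 0 < Pfun f P δ' v) {W : ℝ → ℝ}
    (hW0 : ∀ s, 0 < s → 0 ≤ W s)
    (hW : ∀ s, 0 < s → Tendsto (fun t => prec f s (VrNoisy f P δ s t)) atTop (𝓝 (W s)))
    (hV : ∀ s, 0 < s → Tendsto (VrNoisy f P δ s) atTop (𝓝 (specPsi P δ (W s))⁻¹))
    {ε : ℝ} (hε : 0 < ε) : ∀ᶠ s in 𝓝[>] (0 : ℝ), (specPsi P δ (W s))⁻¹ < ε := by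
  have hf := D.measurable
  -- Compactness makes one range of `s` work for all `v` in `[ε, 1]`. The precision bound is
  -- required on a neighbourhood of `v` because the iterates only approach their limit. A limit `V ≥
  -- ε` would then give `W ≥ w`, hence `specPsi P δ W ≥ specPsi P δ w > 1 / V = specPsi P δ W`.
  have key : ∀ᶠ s in 𝓝 (0 : ℝ), ∀ v ∈ Set.Icc ε 1, 0 < s → ∃ w, 0 ≤ w ∧ v⁻¹ < specPsi P δ w ∧
      ∀ᶠ u in 𝓝 v, 0 < u → u ≤ 1 → w ≤ prec f s u := by
    refine isCompact_Icc.eventually_forall_of_forall_eventually fun v₀ hv₀ => ?_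
    have hv₀p : 0 < v₀ := hε.trans_le hv₀.1
    obtain ⟨w, hw, h1, h2⟩ := exists_precision_gap hP hf hδ' hv₀p hv₀.2 (hpos v₀ hv₀p hv₀.2)
    obtain ⟨c, hc1, hc2⟩ := exists_between h2
    have e1 := eventually_nhdsWithin_iff.1 (D.eventually_mmseZNoisy_lt hv₀p hc1)
    have e2 : ∀ᶠ x : ℝ × ℝ in 𝓝 (v₀, 0), c < (w + x.1⁻¹)⁻¹ := by
      have hca : ContinuousAt (fun x : ℝ × ℝ => (w + x.1⁻¹)⁻¹) (v₀, 0) := by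
        have hne : v₀ ≠ 0 := hv₀p.ne'
        have hne2 : w + v₀⁻¹ ≠ 0 := by positivity
        exact ((continuousAt_const.add (continuousAt_fst.inv₀ hne))).inv₀ hne2
      exact hca.eventually (lt_mem_nhds hc2)
    have e3 : ∀ᶠ x : ℝ × ℝ in 𝓝 (v₀, 0), x.1⁻¹ < specPsi P δ w := by
      have hca : ContinuousAt (fun x : ℝ × ℝ => x.1⁻¹) (v₀, 0) := continuousAt_fst.inv₀ hv₀p.ne'
      exact hca.eventually (gt_mem_nhds h1)
    have e4 := (e1.and e2).eventually_nhds.and e3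
    have hswap : Tendsto (fun z : ℝ × ℝ => (z.2, z.1)) (𝓝 (0, v₀)) (𝓝 (v₀, 0)) :=
      (continuous_snd.prodMk continuous_fst).tendsto' _ _ rfl
    filter_upwards [hswap.eventually e4] with z hz hs
    refine ⟨w, hw, hz.2, ?_⟩
    have hsl : Tendsto (fun u : ℝ => (u, z.1)) (𝓝 z.2) (𝓝 (z.2, z.1)) :=
      (continuous_id.prodMk continuous_const).tendsto' _ _ rfl
    filter_upwards [hsl.eventually hz.1] with u hu hu0 hu1
    have hlt := (hu.1 ⟨hu0, hu1, hs.le⟩).trans hu.2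
    have hup : 0 < u⁻¹ := inv_pos.2 hu0
    rw [lt_inv_comm₀ (mmseZNoisy_pos hf hs hu0 hu1) (by linarith)] at hlt
    unfold prec
    linarith
  filter_upwards [nhdsWithin_le_nhds key, self_mem_nhdsWithin] with s hs hs0
  rw [Set.mem_Ioi] at hs0
  by_contra! hge
  have h1 := hP.one_le_specPsi (hW0 s hs0)
  obtain ⟨w, hw, hlt, hev⟩ := hs _ ⟨hge, inv_le_one_of_one_le₀ h1⟩ hs0
  rw [inv_inv] at hlt
  have hmem := hP.VrNoisy_mem hf hs0
  have hle : w ≤ W s := by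
    refine ge_of_tendsto (hW s hs0) ?_
    filter_upwards [(hV s hs0).eventually hev] with t ht
    exact ht (hmem t).1 (hmem t).2
  exact absurd (hP.specPsi_mono hw hle) (not_le.2 hlt)

/-- The limiting error is linear in the noise level. -/
lemma tendsto_specMu_div (hP : IsSpectralLaw P δ) (D : Pieces f) (hp : 0 < D.p)
    {δ' : ℝ} (hδ'1 : 1 < δ') (hδ' : δ' < δ)
    (hpos : ∀ v, 0 < v → v ≤ 1 → 0 < Pfun f P δ' v) {W : ℝ → ℝ}
    (hW0 : ∀ s, 0 < s → 0 ≤ W s)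
    (hW : ∀ s, 0 < s → Tendsto (fun t => prec f s (VrNoisy f P δ s t)) atTop (𝓝 (W s)))
    (hV : ∀ s, 0 < s → Tendsto (VrNoisy f P δ s) atTop (𝓝 (specPsi P δ (W s))⁻¹)) :
    1 < D.p * δ ∧ Tendsto (fun s => specMu P (W s) / s) (𝓝[>] 0)
      (𝓝 ((δ - 1) / (D.p * δ - 1) * ∫ x, x⁻¹ ∂P)) := by
  have hf := D.measurable
  have hδ := hP.one_lt
  have hpδ : 1 < D.p * δ := by
    have h1 := one_le_mul_p hP D hp hδ'1 hpos
    nlinarith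
  refine ⟨hpδ, ?_⟩
  set V : ℝ → ℝ := fun s => (specPsi P δ (W s))⁻¹ with hVdef
  have hsmall : ∀ ε, 0 < ε → ∀ᶠ s in 𝓝[>] (0 : ℝ), V s < ε := fun ε hε =>
    eventually_fixedPoint_lt hP D hδ' hpos hW0 hW hV hε
  have hPsi : ∀ s, 0 < s → 1 ≤ specPsi P δ (W s) := fun s hs => hP.one_le_specPsi (hW0 s hs)
  have hVpos : ∀ s, 0 < s → 0 < V s := fun s hs => by
    have := hPsi s hs
    simp only [hVdef]
    positivity
  have hWtop : Tendsto W (𝓝[>] 0) atTop := by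
    obtain ⟨B, hB⟩ := hP.exists_specPsi_le
    refine tendsto_atTop.2 fun b => ?_
    have hpos' : 0 < ((δ - 1) * |b| + |B| + 1)⁻¹ := by
      have := mul_nonneg (by linarith : 0 ≤ δ - 1) (abs_nonneg b)
      positivity
    filter_upwards [hsmall _ hpos', self_mem_nhdsWithin] with s hs hs0
    rw [Set.mem_Ioi] at hs0
    have h1 := hPsi s hs0
    have h2 := hB (W s) (hW0 s hs0)
    have h3 := (inv_lt_inv₀ (by linarith) (by
      have := mul_nonneg (by linarith : 0 ≤ δ - 1) (abs_nonneg b)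
      positivity)).1 hs
    have h4 : (δ - 1) * |b| < (δ - 1) * W s := by linarith [le_abs_self B]
    exact (le_abs_self b).trans (lt_of_mul_lt_mul_left h4 (by linarith)).le
  have hμ : Tendsto (fun s => specMu P (W s)) (𝓝[>] 0) (𝓝 0) := hP.tendsto_specMu.comp hWtop
  set Q : ℝ → ℝ := fun s => (1 + V s * W s)⁻¹ with hQdef
  have hQ : Tendsto Q (𝓝[>] 0) (𝓝 ((δ - 1) / δ)) := by
    have h1 := (hμ.const_add (δ - 1)).div_const δ
    rw [add_zero] at h1
    refine h1.congr' ?_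
    filter_upwards [self_mem_nhdsWithin] with s hs
    exact (hP.ratio_limit_eq (hW0 s hs)).symm
  have hdiff : Tendsto (fun s => Q s - (1 - D.p * (V s / (V s + s)))) (𝓝[>] 0) (𝓝 0) := by
    rw [Metric.tendsto_nhds]
    intro η hη
    have e := eventually_nhdsWithin_iff.1
      (D.tendsto_ratio.eventually (Metric.ball_mem_nhds 0 (half_pos hη)))
    obtain ⟨r, hr, hball⟩ := Metric.eventually_nhds_iff.1 e
    filter_upwards [hsmall r hr, Ioo_mem_nhdsGT hr] with s hs1 hs2
    have hs0 : 0 < s := hs2.1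
    have hVs := hVpos s hs0
    -- The estimate near the origin is applied to the iterates and passed to the limit in `t`, which
    -- avoids evaluating the MMSE at `V s` itself.
    have hlim := (hP.tendsto_ratio_limit hf hs0 (hW s hs0) (hV s hs0) (hW0 s hs0)).sub
      ((((hV s hs0).div ((hV s hs0).add_const s) (by
        have : 0 < V s + s := by positivity
        exact this.ne')).const_mul D.p).const_sub 1)
    have hle : |Q s - (1 - D.p * (V s / (V s + s)))| ≤ η / 2 := by
      refine le_of_tendsto hlim.abs ?_
      filter_upwards [(hV s hs0).eventually (gt_mem_nhds hs1)] with t ht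
      have hmem := hP.VrNoisy_mem hf hs0 t
      have hb := hball (y := (VrNoisy f P δ s t, s)) (by
        rw [Prod.dist_eq, max_lt_iff]
        simp only [Real.dist_eq, sub_zero]
        rw [abs_of_pos hmem.1, abs_of_pos hs0]
        exact ⟨ht, hs2.2⟩) ⟨hmem.1, hmem.2, hs0.le⟩
      rw [Real.dist_eq, sub_zero] at hb
      exact hb.le
    rw [Real.dist_eq, sub_zero]
    linarith
  have hδ0 : δ ≠ 0 := by linarith
  have hθ : Tendsto (fun s => V s / (V s + s)) (𝓝[>] 0) (𝓝 (D.p * δ)⁻¹) := by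
    -- Solves `1 - p θ = (δ - 1) / δ` for the limit `θ` of `V / (V + s)`.
    have h1 := ((hdiff.sub hQ).add_const 1).div_const D.p
    have h2 : (0 - (δ - 1) / δ + 1) / D.p = (D.p * δ)⁻¹ := by
      field_simp
      ring
    rw [h2] at h1
    refine h1.congr fun s => ?_
    field_simp
    ring
  have hsV : Tendsto (fun s => s / V s) (𝓝[>] 0) (𝓝 (D.p * δ - 1)) := by
    have h1 := (hθ.inv₀ (by positivity)).sub_const 1
    rw [inv_inv] at h1
    refine h1.congr' ?_
    filter_upwards [self_mem_nhdsWithin] with s hs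
    have := hVpos s hs
    rw [inv_div, add_div, div_self this.ne']
    ring
  have hVW : Tendsto (fun s => V s * W s) (𝓝[>] 0) (𝓝 (δ - 1)⁻¹) := by
    have hne : (δ - 1) / δ ≠ 0 := div_ne_zero (by linarith) hδ0
    have h1 := (hQ.inv₀ hne).sub_const 1
    have h2 : ((δ - 1) / δ)⁻¹ - 1 = (δ - 1)⁻¹ := by
      have : δ - 1 ≠ 0 := by linarith
      field_simp
      ring
    rw [h2] at h1
    refine h1.congr fun s => ?_
    simp only [hQdef, inv_inv]
    ring
  have hsW : Tendsto (fun s => s * W s) (𝓝[>] 0) (𝓝 ((D.p * δ - 1) * (δ - 1)⁻¹)) := by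
    refine (hsV.mul hVW).congr' ?_
    filter_upwards [self_mem_nhdsWithin] with s hs
    have := hVpos s hs
    field_simp
  have hfin := (hP.tendsto_mul_specMu.comp hWtop).div hsW
    (mul_ne_zero (by linarith) (inv_ne_zero (by linarith)))
  have hval : (∫ x, x⁻¹ ∂P) / ((D.p * δ - 1) * (δ - 1)⁻¹)
      = (δ - 1) / (D.p * δ - 1) * ∫ x, x⁻¹ ∂P := by
    have h1 : D.p * δ - 1 ≠ 0 := by linarith
    have h2 : δ - 1 ≠ 0 := by linarith
    field_simp
  rw [hval] at hfin
  refine hfin.congr' ?_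
  filter_upwards [self_mem_nhdsWithin, hWtop.eventually_gt_atTop 0] with s hs hWs
  rw [Set.mem_Ioi] at hs
  change W s * specMu P (W s) / (s * W s) = specMu P (W s) / s
  field_simp

end Threshold

end GLMEP

theorem mainTheorem8 (f : ℝ → ℝ) (hf : GLMEP.PiecewiseSmooth f)
    (d : ℝ≥0) (hd : GLMEP.HasInformationDimension (GLMEP.outputLaw f) d) (hd0 : d ≠ 0)
    (δ : ℝ) (hδ : 1 < δ) :
    ∃ C : ℝ, 0 < C ∧
      ∀ P : Measure ℝ, GLMEP.IsSpectralLaw P δ → GLMEP.perfectThreshold f P < (δ : EReal) →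
        (∀ s : ℝ, 0 < s →
          Tendsto (fun t : ℕ => GLMEP.mse P (GLMEP.VlNoisy f P δ s t)) atTop
            (𝓝 (GLMEP.mseStarNoisy f P δ s))) ∧
        (fun s : ℝ => GLMEP.mseStarNoisy f P δ s)
          ~[𝓝[>] (0 : ℝ)] (fun s : ℝ => C * (∫ x, x⁻¹ ∂P) * s) ∧
        ∃ K : ℝ, ∀ s : ℝ, 0 < s → GLMEP.mseStarNoisy f P δ s ≤ K * s := by
  obtain ⟨D⟩ := hf.nonempty_pieces
  have hp := D.p_pos hd hd0
  have hfm := D.measurable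
  -- The constant must be chosen before `P`. The default `1` is harmless: any admissible `P` forces
  -- `p δ > 1`.
  refine ⟨if 1 < D.p * δ then (δ - 1) / (D.p * δ - 1) else 1, ?_, ?_⟩
  · split_ifs with h
    · exact div_pos (by linarith) (by linarith)
    · exact one_pos
  intro P hP hthr
  obtain ⟨δ', hδ'1, hδ', hpos⟩ := GLMEP.exists_of_perfectThreshold_lt hP hfm hthr
  have hex : ∀ s : ℝ, ∃ W, 0 < s → 0 ≤ W ∧
      Tendsto (fun t => GLMEP.prec f s (GLMEP.VrNoisy f P δ s t)) atTop (𝓝 W) ∧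
      Tendsto (GLMEP.VrNoisy f P δ s) atTop (𝓝 (GLMEP.specPsi P δ W)⁻¹) := by
    intro s
    by_cases hs : 0 < s
    · obtain ⟨W, h⟩ := hP.exists_limit hfm hs
      exact ⟨W, fun _ => h⟩
    · exact ⟨0, fun h => absurd h hs⟩
  choose W hWs using hex
  obtain ⟨hpδ, hlim⟩ := GLMEP.tendsto_specMu_div hP D hp hδ'1 hδ' hpos
    (fun s hs => (hWs s hs).1) (fun s hs => (hWs s hs).2.1) (fun s hs => (hWs s hs).2.2)
  have hmse : ∀ s, 0 < s → Tendsto (fun t : ℕ => GLMEP.mse P (GLMEP.VlNoisy f P δ s t)) atTop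
      (𝓝 (GLMEP.specMu P (W s))) := fun s hs =>
    hP.tendsto_mse hfm hs (hWs s hs).1 (hWs s hs).2.1
  have hstar : ∀ s, 0 < s → GLMEP.mseStarNoisy f P δ s = GLMEP.specMu P (W s) := fun s hs =>
    (hmse s hs).limUnder_eq
  rw [if_pos hpδ]
  set C := (δ - 1) / (D.p * δ - 1)
  have hC : 0 < C := div_pos (by linarith) (by linarith)
  have hE := hP.integral_inv_pos
  have hlim' : Tendsto (fun s => GLMEP.mseStarNoisy f P δ s / s) (𝓝[>] 0)
      (𝓝 (C * ∫ x, x⁻¹ ∂P)) := by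
    refine hlim.congr' ?_
    filter_upwards [self_mem_nhdsWithin] with s hs
    rw [hstar s hs]
  refine ⟨fun s hs => ?_, ?_, ?_⟩
  · rw [hstar s hs]
    exact hmse s hs
  · refine (isEquivalent_iff_tendsto_one ?_).2 ?_
    · filter_upwards [self_mem_nhdsWithin] with s hs
      rw [Set.mem_Ioi] at hs
      positivity
    · have h1 := hlim'.div_const (C * ∫ x, x⁻¹ ∂P)
      rw [div_self (by positivity)] at h1
      refine h1.congr fun s => ?_
      simp only [Pi.div_apply]
      rw [div_div, mul_comm s]
  · have e := hlim'.eventually (gt_mem_nhds (lt_add_one (C * ∫ x, x⁻¹ ∂P)))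
    obtain ⟨s₀, hs₀, hsub⟩ := mem_nhdsGT_iff_exists_Ioo_subset.1 e
    rw [Set.mem_Ioi] at hs₀
    -- Below `s₀` the asymptotics bound the ratio; above it the error is at most `1 ≤ s / s₀`.
    refine ⟨max (C * (∫ x, x⁻¹ ∂P) + 1) s₀⁻¹, fun s hs => ?_⟩
    rcases lt_or_ge s s₀ with hlt | hge
    · have h1 := hsub ⟨hs, hlt⟩
      rw [Set.mem_ofPred_eq, div_lt_iff₀ hs] at h1
      refine h1.le.trans ?_
      gcongr
      exact le_max_left _ _
    · rw [hstar s hs]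
      refine (hP.specMu_le_one (hWs s hs).1).trans ?_
      calc (1 : ℝ) = s₀⁻¹ * s₀ := (inv_mul_cancel₀ hs₀.ne').symm
        _ ≤ max (C * (∫ x, x⁻¹ ∂P) + 1) s₀⁻¹ * s := by
          gcongr
          exact le_max_right _ _
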